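/- \textbf{Proposition (Reduction of the dKdV equation on warped products).} All objects are smooth. Let $M=\prod_{j=1}^k M_j$ be a connected product of manifolds of positive dimension, with a pseudo-Riemannian metric $g$. For $p\in M$ let $\tau_j^{p}:M_j\to M$, $q\mapsto(p_1,\dots,p_{j-1},q,p_{j+1},\dots,p_k)$, be the embedding of $M_j$ as the leaf through $p$, and let $E_j$ be the distribution on $M$ tangent to the leaves of $M_j$. Let $K$ be a Killing tensor of $(M,g)$, i.e. a symmetric contravariant $2$-tensor whose Schouten bracket with the contravariant metric vanishes, and suppose that its eigenspaces are exactly $E_1,\dots,E_k$: there are functions $\lambda_1,\dots,\lambda_k$ on $M$ with $E_j=\ker(K-\lambda_j I)$ at every point, where $K$ is viewed as an endomorphism of $TM$. Fix $i$ and suppose that $E_i$ is a Killing distribution: it is non-degenerate, it is spherical (there is a section $H$ of $E_i^\perp$ such that, for all local sections $X,Y$ of $E_i$, the $E_i^\perp$-component of $\nabla_XY$ is $g(X,Y)H$ and the $E_i^\perp$-component of $\nabla_XH$ is $0$), and $E_i^\perp$ is geodesic ($\nabla_XY\in E_i^\perp$ for all local sections $X,Y$ of $E_i^\perp$). Here $\nabla$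 is the Levi-Civita connection of $g$. Fix $\bar p\in M$, put $\tau_i=\tau_i^{\bar p}$, and let $g_i$ be a pseudo-Riemannian metric on $M_i$ which agrees, up to a positive constant factor, with the metric induced on the leaf through $\bar p$: $\tau_i^*g=c\,g_i$ with a constant $c>0$. Let $\tilde K_i$ be a Killing tensor of $(M_i,g_i)$ and let $K_i$ be its lift to $M$, $K_i|_p=(d\tau_i^{p})_*\,(\tilde K_i|_{p_i})$. Let $V$ be a function on $M$ and $V_i=V\circ\tau_i$. If $d(K\,dV)=0$ on $M$, then $$ d(K_i\,dV)=0\ \text{ on } M \quad\Longleftrightarrow\quad d(\tilde K_i\,dV_i)=0\ \text{ on } M_i , $$ where, in each equation, the $2$-tensor acts on one-forms as an endomorphism of the cotangent bundle, an index being lowered with $g$ on $M$ and with $g_i$ on $M_i$. -/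

import Mathlib

open Set Topology
open scoped Manifold ContDiff

noncomputable section

namespace PseudoRiem

section Manifold

variable {E : Type*} [NormedAddCommGroup E] [NormedSpace ℝ E]
  {H : Type*} [TopologicalSpace H] (I : ModelWithCorners ℝ E H)
  {M : Type*} [TopologicalSpace M] [ChartedSpace H M]

/-! Throughout, `M` is a manifold without boundary, and "in the chart at `x`" refers to the
preferred chart `extChartAt I x` of `M` at `x`, which maps a neighbourhood of `x` onto an open
subset of the model space `E`. -/

/-- The differential at `p` of the chart at `x`. -/
def chartD (x p : M) : TangentSpace I p →L[ℝ] E :=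
  mfderiv I 𝓘(ℝ, E) (extChartAt I x) p

/-- The differential at `e` of the inverse of the chart at `x`. -/
def chartSymmD (x : M) (e : E) : E →L[ℝ] TangentSpace I ((extChartAt I x).symm e) :=
  mfderiv 𝓘(ℝ, E) I (extChartAt I x).symm e

/-- The components, in the chart at `x`, of a vector field `X`. -/
def coordVec (X : ∀ p : M, TangentSpace I p) (x : M) (e : E) : E :=
  chartD I x ((extChartAt I x).symm e) (X ((extChartAt I x).symm e))

/-- The components, in the chart at `x`, of a one-form `η`. -/
def coordForm (η : ∀ p : M, TangentSpace I p →L[ℝ] ℝ) (x : M) (e : E) : E →L[ℝ] ℝ :=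
  (η ((extChartAt I x).symm e)).comp (chartSymmD I x e)

/-- The components, in the chart at `x`, of a covariant two-tensor `g`. -/
def coordCov (g : ∀ p : M, TangentSpace I p →L[ℝ] TangentSpace I p →L[ℝ] ℝ) (x : M) (e : E) :
    E →L[ℝ] E →L[ℝ] ℝ :=
  (ContinuousLinearMap.precomp ℝ (chartSymmD I x e)).comp
    ((g ((extChartAt I x).symm e)).comp (chartSymmD I x e))

/-- The components, in the chart at `x`, of a contravariant two-tensor `K`. A contravariant
two-tensor at `p` is viewed as a linear map `T*_p M → T_p M`, `α ↦ K(α, ·)`. -/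
def coordContra (K : ∀ p : M, (TangentSpace I p →L[ℝ] ℝ) →L[ℝ] TangentSpace I p) (x : M) (e : E) :
    (E →L[ℝ] ℝ) →L[ℝ] E :=
  (chartD I x ((extChartAt I x).symm e)).comp
    ((K ((extChartAt I x).symm e)).comp
      (ContinuousLinearMap.precomp ℝ (chartD I x ((extChartAt I x).symm e))))

/-- The vector field `X` is smooth on the open set `U`: its components in charts are smooth. -/
def SmoothVecOn (U : Set M) (X : ∀ p : M, TangentSpace I p) : Prop :=
  ∀ x : M, ContDiffOn ℝ ∞ (coordVec I X x)
    ((extChartAt I x).target ∩ (extChartAt I x).symm ⁻¹' U)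

variable (M) in
/-- A smooth pseudo-Riemannian metric (of arbitrary signature) on `M`. -/
structure Metric where
  /-- The bilinear form on each tangent space, which is also the musical map `T_p M → T*_p M`. -/
  val : ∀ p : M, TangentSpace I p →L[ℝ] TangentSpace I p →L[ℝ] ℝ
  symm : ∀ p u v, val p u v = val p v u
  nondegenerate : ∀ p u, (∀ v, val p u v = 0) → u = 0
  smooth : ∀ x : M, ContDiffOn ℝ ∞ (coordCov I val x) (extChartAt I x).target

variable (M) in
/-- The smooth symmetric contravariant two-tensor fields on `M`, i.e. the elements of `S²(M)`. -/
structure SymTensor where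
  /-- The tensor at `p`, viewed as the linear map `α ↦ K(α, ·)` from `T*_p M` to `T_p M`. -/
  val : ∀ p : M, (TangentSpace I p →L[ℝ] ℝ) →L[ℝ] TangentSpace I p
  symm : ∀ (p : M) (α β : TangentSpace I p →L[ℝ] ℝ), β (val p α) = α (val p β)
  smooth : ∀ x : M, ContDiffOn ℝ ∞ (coordContra I val x) (extChartAt I x).target

variable {I}

/-- The contravariant metric `G`, i.e. the inverse of `g`, as a map `T*_p M → T_p M`. -/
def Metric.contra (g : Metric I M) (p : M) : (TangentSpace I p →L[ℝ] ℝ) →L[ℝ] TangentSpace I p :=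
  (g.val p).inverse

variable (I) in
/-- The Schouten bracket `[K, G]` of two symmetric contravariant two-tensors, as the cubic form
`ξ ↦ [K, G](ξ, ξ, ξ) = 2 K^{il} ξ_i ∂_l G^{jk} ξ_j ξ_k - 2 G^{il} ξ_i ∂_l K^{jk} ξ_j ξ_k`
in the chart at `x`, evaluated at `x`. -/
def schouten (K G : ∀ p : M, (TangentSpace I p →L[ℝ] ℝ) →L[ℝ] TangentSpace I p)
    (x : M) (ξ : E →L[ℝ] ℝ) : ℝ :=
  2 * fderiv ℝ (fun e => ξ (coordContra I G x e ξ)) (extChartAt I x x)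
      (coordContra I K x (extChartAt I x x) ξ)
    - 2 * fderiv ℝ (fun e => ξ (coordContra I K x e ξ)) (extChartAt I x x)
      (coordContra I G x (extChartAt I x x) ξ)

/-- `K` is a Killing tensor of `(M, g)`: its Schouten bracket with the metric vanishes. -/
def IsKillingTensor (g : Metric I M) (K : SymTensor I M) : Prop :=
  ∀ (x : M) (ξ : E →L[ℝ] ℝ), schouten I K.val g.contra x ξ = 0

/-- The endomorphism of `T_p M` given by the contravariant two-tensor `K`
(one index being lowered by `g`). -/
def Metric.endo (g : Metric I M) (K : SymTensor I M) (p : M) :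
    Module.End ℝ (TangentSpace I p) :=
  ((K.val p).comp (g.val p) : TangentSpace I p →L[ℝ] TangentSpace I p)

variable (I) in
/-- The differential of the function `V`. -/
def diff (V : M → ℝ) (p : M) : TangentSpace I p →L[ℝ] ℝ :=
  mfderiv I 𝓘(ℝ, ℝ) V p

variable (I) in
/-- The exterior derivative of the one-form `η` at `x`, computed in the chart at `x`. -/
def extD (η : ∀ p : M, TangentSpace I p →L[ℝ] ℝ) (x : M) (u v : TangentSpace I x) : ℝ :=
  fderiv ℝ (coordForm I η x) (extChartAt I x x) (chartD I x x u) (chartD I x x v)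
    - fderiv ℝ (coordForm I η x) (extChartAt I x x) (chartD I x x v) (chartD I x x u)

/-- The equation `d(K dV) = 0`, where the contravariant two-tensor `K` acts on one-forms as an
endomorphism of the cotangent bundle (one index being lowered by `g`). -/
def DKdV (g : Metric I M) (K : ∀ p : M, (TangentSpace I p →L[ℝ] ℝ) →L[ℝ] TangentSpace I p)
    (V : M → ℝ) : Prop :=
  ∀ (x : M) (u v : TangentSpace I x),
    extD I (fun p => g.val p (K p (diff I V p))) x u v = 0

/-- The Christoffel symbols of the second kind of `g` at `x`, in the chart at `x`:
`g(Γ(u, v), w) = (∂_u g(v, w) + ∂_v g(u, w) - ∂_w g(u, v)) / 2`. -/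
def Metric.christoffel (g : Metric I M) (x : M) (u v : E) : E :=
  (coordCov I g.val x (extChartAt I x x)).inverse
    ((1 / 2 : ℝ) • (fderiv ℝ (coordCov I g.val x) (extChartAt I x x) u v
      + fderiv ℝ (coordCov I g.val x) (extChartAt I x x) v u
      - ((fderiv ℝ (coordCov I g.val x) (extChartAt I x x)).flip u).flip v))

/-- The Levi-Civita covariant derivative `∇_X Y` at `x`. -/
def Metric.covDeriv (g : Metric I M) (X Y : ∀ p : M, TangentSpace I p) (x : M) :
    TangentSpace I x :=
  (chartD I x x).inverse
    (fderiv ℝ (coordVec I Y x) (extChartAt I x x) (chartD I x x (X x))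
      + g.christoffel x (chartD I x x (X x)) (chartD I x x (Y x)))

/-- `X` is a smooth section, over the open set `U`, of the distribution `D`. -/
def IsSectionOn (D : ∀ p : M, Submodule ℝ (TangentSpace I p)) (U : Set M)
    (X : ∀ p : M, TangentSpace I p) : Prop :=
  SmoothVecOn I U X ∧ ∀ p ∈ U, X p ∈ D p

/-- The orthogonal complement of the distribution `D`. -/
def Metric.orth (g : Metric I M) (D : ∀ p : M, Submodule ℝ (TangentSpace I p)) (p : M) :
    Submodule ℝ (TangentSpace I p) where
  carrier := {v | ∀ w ∈ D p, g.val p v w = 0}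
  add_mem' := fun {a b} ha hb w hw => by simp [ha w hw, hb w hw]
  zero_mem' := fun w _ => by simp
  smul_mem' := fun c a ha w hw => by simp [ha w hw]

/-- `D` is non-degenerate: `g` restricts to a non-degenerate form on each `D p`. -/
def IsNondegenerate (g : Metric I M) (D : ∀ p : M, Submodule ℝ (TangentSpace I p)) : Prop :=
  ∀ p, D p ⊓ g.orth D p = ⊥

/-- `D` is geodesic: `∇_X Y` is a section of `D` for all (local) sections `X`, `Y` of `D`. -/
def IsGeodesic (g : Metric I M) (D : ∀ p : M, Submodule ℝ (TangentSpace I p)) : Prop :=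
  ∀ (U : Set M) (X Y : ∀ p : M, TangentSpace I p), IsOpen U →
    IsSectionOn D U X → IsSectionOn D U Y → ∀ p ∈ U, g.covDeriv X Y p ∈ D p

/-- `D` is spherical: there is a section `N` of the orthogonal complement of `D` (the mean
curvature normal) such that, for all (local) sections `X`, `Y` of `D`, the normal component of
`∇_X Y` is `g(X, Y) N` (`D` is umbilical) and the normal component of `∇_X N` vanishes. -/
def IsSpherical (g : Metric I M) (D : ∀ p : M, Submodule ℝ (TangentSpace I p)) : Prop :=
  ∃ N : ∀ p : M, TangentSpace I p, IsSectionOn (g.orth D) univ N ∧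
    (∀ (U : Set M) (X Y : ∀ p : M, TangentSpace I p), IsOpen U →
      IsSectionOn D U X → IsSectionOn D U Y → ∀ p ∈ U, ∀ z ∈ g.orth D p,
        g.val p (g.covDeriv X Y p) z = g.val p (X p) (Y p) * g.val p (N p) z) ∧
    (∀ (U : Set M) (X : ∀ p : M, TangentSpace I p), IsOpen U →
      IsSectionOn D U X → ∀ p ∈ U, ∀ z ∈ g.orth D p,
        g.val p (g.covDeriv X N p) z = 0)

/-- `D` is a Killing distribution: it is non-degenerate and spherical, and its orthogonal
complement is geodesic. -/
def IsKillingDistribution (g : Metric I M) (D : ∀ p : M, Submodule ℝ (TangentSpace I p)) :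
    Prop :=
  IsNondegenerate g D ∧ IsSpherical g D ∧ IsGeodesic g (g.orth D)

end Manifold

section Product

variable {ι : Type*} [Fintype ι] [DecidableEq ι]
  {E : ι → Type*} [∀ j, NormedAddCommGroup (E j)] [∀ j, NormedSpace ℝ (E j)]
  {M : ι → Type*} [∀ j, TopologicalSpace (M j)] [∀ j, ChartedSpace (E j) (M j)]

variable (E) in
/-- The model with corners (without boundary) of the product manifold `∏ j, M j`, where `M j` is
modelled on `E j`. -/
abbrev prodModel : ModelWithCorners ℝ (∀ j, E j) (ModelPi E) :=
  ModelWithCorners.pi fun j => 𝓘(ℝ, E j)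

/-- The canonical embedding `τ_i : M i → ∏ j, M j` onto the leaf through `p`. -/
def leafMap (p : ∀ j, M j) (i : ι) : M i → ∀ j, M j := Function.update p i

variable (E) in
/-- The differential of `τ_i : M i → ∏ j, M j` at the point `q` of `M i`. -/
def leafMapD (p : ∀ j, M j) (i : ι) (q : M i) :
    TangentSpace 𝓘(ℝ, E i) q →L[ℝ] TangentSpace (prodModel E) (leafMap p i q) :=
  mfderiv 𝓘(ℝ, E i) (prodModel E) (leafMap p i) q

variable (E) in
/-- The inclusion `T_{p_i} M i → T_p (∏ j, M j)`: the differential at `p i` of the embedding `τ_i`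
onto the leaf through `p` (note that `τ_i (p i) = p`). -/
def factorIncl (p : ∀ j, M j) (i : ι) :
    TangentSpace 𝓘(ℝ, E i) (p i) →L[ℝ] TangentSpace (prodModel E) p :=
  leafMapD E p i (p i)

variable (E) in
/-- The distribution `E_i` of the product net: the tangent spaces of the leaves of `M i`. -/
def productNet (i : ι) (p : ∀ j, M j) : Submodule ℝ (TangentSpace (prodModel E) p) :=
  LinearMap.range (factorIncl E p i : TangentSpace 𝓘(ℝ, E i) (p i) →ₗ[ℝ] _)

/-- The lift to `∏ j, M j` of a contravariant two-tensor on `M i`. -/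
def liftTensor (i : ι) (K : SymTensor 𝓘(ℝ, E i) (M i)) (p : ∀ j, M j) :
    (TangentSpace (prodModel E) p →L[ℝ] ℝ) →L[ℝ] TangentSpace (prodModel E) p :=
  (factorIncl E p i).comp
    ((K.val (p i)).comp (ContinuousLinearMap.precomp ℝ (factorIncl E p i)))

end Product

end PseudoRiem

end

/-! In a product chart the distributions $E_j$ are spanned by coordinate fields. The eigenspaces of
the self-adjoint endomorphism $K$ are orthogonal, so the matrix of $g$ is block diagonal. Let $u$ be
a constant vector along $M_i$ and $z$ one along $M_j$, $j \ne i$.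

By the Koszul formula, geodesy of $E_i^\perp$ gives $\partial_u g(z,z)=0$, and umbilicity of $E_i$
gives $\partial_z g(u,u') = -2\theta(z)\,g(u,u')$ with $\theta = g(N,\cdot)$. Polarising the Killing
equation of $K$ over $u \pm z$ (`IsKillingTensor.fderiv_eigenvalue`) then yields
$\partial_u\lambda_j = 0$ and $\partial_z\lambda_i = -2(\lambda_i-\lambda_j)\theta(z)$. Inserted in
the $(u,z)$ component of $d(K\,dV)=0$, and divided by $\lambda_j-\lambda_i\ne 0$, this becomes
$\partial_z\partial_u V = 2\theta(z)\,\partial_u V$ (`exists_conformal_factor`).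

Thus along the other factors $g|_{E_i}$ and $dV|_{E_i}$ scale with opposite rates, while the
components of $K_i$ do not change. Hence the $M_i$-components of $K_i\,dV$ are constant along the
other factors; its remaining components vanish by orthogonality. Comparison on the leaf through
$\bar p$ gives $K_i\,dV = c\,\pi_i^*(\tilde K_i\,dV_i)$ (`val_liftTensor_eq`). Since $d$ commutes
with $\pi_i^*$ (`extD_of_eq_pullback`), $c \ne 0$ and $\pi_i$ is a surjective submersion, the two
closedness conditions agree. -/

noncomputable section

namespace PseudoRiem

/-! ### Charts, coordinate fields and components of tensors -/

section Charts

variable {E : Type*} [NormedAddCommGroup E] [NormedSpace ℝ E]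
  {H : Type*} [TopologicalSpace H] {I : ModelWithCorners ℝ E H}
  {M : Type*} [TopologicalSpace M] [ChartedSpace H M]

variable (I) in
/-- The coordinate vector field of the chart at `x` with constant components `w`. -/
def coordField (x : M) (w : E) (p : M) : TangentSpace I p :=
  (chartD I x p).inverse w

lemma chartD_self [IsManifold I ∞ M] (x : M) (v : TangentSpace I x) : chartD I x x v = v := by
  have h := mfderiv_extChartAt_self (I := I) (x := x)
  exact DFunLike.congr_fun h v

lemma chartD_isInvertible [IsManifold I ∞ M] {x p : M} (hp : p ∈ (extChartAt I x).source) :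
    (chartD I x p).IsInvertible :=
  isInvertible_mfderiv_extChartAt hp

lemma chartD_coordField [IsManifold I ∞ M] {x p : M} (hp : p ∈ (extChartAt I x).source) (w : E) :
    chartD I x p (coordField I x w p) = w :=
  (chartD_isInvertible hp).self_apply_inverse w

lemma coordField_chartD [IsManifold I ∞ M] {x p : M} (hp : p ∈ (extChartAt I x).source)
    (w : TangentSpace I p) : coordField I x (chartD I x p w) p = w :=
  (chartD_isInvertible hp).inverse_apply_self w

variable [IsManifold I ∞ M] [I.Boundaryless]

lemma chartD_chartSymmD {x : M} {e : E} (he : e ∈ (extChartAt I x).target) (v : E) :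
    chartD I x ((extChartAt I x).symm e) (chartSymmD I x e v) = v := by
  have h := mfderiv_extChartAt_comp_mfderivWithin_extChartAt_symm (I := I) he
  rw [I.range_eq_univ, mfderivWithin_univ] at h
  exact DFunLike.congr_fun h v

lemma chartSymmD_chartD {x : M} {e : E} (he : e ∈ (extChartAt I x).target)
    (w : TangentSpace I ((extChartAt I x).symm e)) :
    chartSymmD I x e (chartD I x ((extChartAt I x).symm e) w) = w := by
  have h := mfderivWithin_extChartAt_symm_comp_mfderiv_extChartAt (I := I) he
  rw [I.range_eq_univ, mfderivWithin_univ] at h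
  exact DFunLike.congr_fun h w

/-- The differential of the inverse chart at its centre is the identity of the model space. -/
lemma chartSymmD_self (x : M) (v : E) :
    (chartSymmD I x (extChartAt I x x) v : E) = v := by
  have h := chartD_chartSymmD (mem_extChartAt_target (I := I) x) v
  -- The point `(extChartAt I x).symm (extChartAt I x x)` equals `x` only propositionally, so the
  -- base point is generalised before substituting.
  have hD : ∀ p : M, p = x → ∀ w : E, (chartD I x p : E →L[ℝ] E) w = w := by
    rintro p rfl w
    exact chartD_self p w
  exact (hD _ (extChartAt_to_inv x) _).symm.trans h

lemma coordField_symm {x : M} {e : E} (he : e ∈ (extChartAt I x).target) (w : E) :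
    coordField I x w ((extChartAt I x).symm e) = chartSymmD I x e w := by
  rw [← coordField_chartD ((extChartAt I x).map_target he) (chartSymmD I x e w),
    chartD_chartSymmD he]

omit [IsManifold I ∞ M] in
lemma target_mem_nhds {x : M} {e : E} (he : e ∈ (extChartAt I x).target) :
    (extChartAt I x).target ∈ 𝓝 e :=
  (isOpen_extChartAt_target x).mem_nhds he

lemma mdifferentiableAt_symm {x : M} {e : E} (he : e ∈ (extChartAt I x).target) :
    MDifferentiableAt 𝓘(ℝ, E) I (extChartAt I x).symm e := by
  have h := mdifferentiableWithinAt_extChartAt_symm (I := I) he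
  rwa [I.range_eq_univ, mdifferentiableWithinAt_univ] at h

lemma fderiv_coordChange {x y : M} {e : E} (he : e ∈ (extChartAt I x).target)
    (hy : (extChartAt I x).symm e ∈ (extChartAt I y).source) (w : E) :
    fderiv ℝ (extChartAt I y ∘ (extChartAt I x).symm) e w =
      chartD I y ((extChartAt I x).symm e) (chartSymmD I x e w) := by
  rw [← mfderiv_eq_fderiv, mfderiv_comp e (I' := I)
    (mdifferentiableAt_extChartAt (by rwa [← extChartAt_source I])) (mdifferentiableAt_symm he)]
  rfl

/-- In another chart the components are the derivative of the coordinate change applied to the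
constant `w`. This makes coordinate fields admissible test sections in the geodesic and spherical
conditions. -/
lemma smoothVecOn_coordField (x : M) (w : E) :
    SmoothVecOn I (extChartAt I x).source (coordField I x w) := by
  intro y
  have hc := contDiffOn_ext_coord_change (I := I) (n := ∞) x y
  have hc' := contDiffOn_ext_coord_change (I := I) (n := ∞) y x
  have ho : IsOpen ((extChartAt I x).symm ≫ extChartAt I y).source := by
    rw [PartialEquiv.trans_source, PartialEquiv.symm_source]
    exact (continuousOn_extChartAt_symm x).isOpen_inter_preimage (isOpen_extChartAt_target x)
      (isOpen_extChartAt_source y)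
  have hd := (hc'.fderiv_of_isOpen ho (m := ∞) (by simp)).clm_apply (contDiffOn_const (c := w))
  have hcomp := hd.comp hc (by
    intro e he
    rw [PartialEquiv.trans_source, PartialEquiv.symm_source] at he ⊢
    refine ⟨(extChartAt I x).map_source he.2, ?_⟩
    simp only [mem_preimage, Function.comp_apply]
    rw [(extChartAt I x).left_inv he.2]
    exact (extChartAt I y).map_target he.1)
  refine hcomp.congr ?_
  intro e he
  have hx : (extChartAt I y).symm e ∈ (extChartAt I x).source := he.2
  have hl := (extChartAt I x).left_inv hx
  simp only [Function.comp_apply]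
  rw [fderiv_coordChange ((extChartAt I x).map_source hx)
    (by rw [hl]; exact (extChartAt I y).map_target he.1),
    ← coordField_symm ((extChartAt I x).map_source hx), hl]
  rfl

omit [I.Boundaryless] in
lemma coordVec_coordField {x : M} {e : E} (he : e ∈ (extChartAt I x).target) (w : E) :
    coordVec I (coordField I x w) x e = w :=
  chartD_coordField ((extChartAt I x).map_target he) w

/-- Leaves only the Christoffel term in the covariant derivative of a coordinate field. -/
lemma fderiv_coordVec_coordField (x : M) (w : E) :
    fderiv ℝ (coordVec I (coordField I x w) x) (extChartAt I x x) = 0 := by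
  have h : coordVec I (coordField I x w) x =ᶠ[𝓝 (extChartAt I x x)] fun _ => w := by
    filter_upwards [target_mem_nhds (mem_extChartAt_target x)] with e he
    exact coordVec_coordField he w
  rw [h.fderiv_eq, fderiv_const_apply]

lemma coordCov_chartD (g : ∀ p : M, TangentSpace I p →L[ℝ] TangentSpace I p →L[ℝ] ℝ) {x p : M}
    (hp : p ∈ (extChartAt I x).source) (a b : TangentSpace I p) :
    coordCov I g x (extChartAt I x p) (chartD I x p a) (chartD I x p b) = g p a b := by
  obtain ⟨e, he, rfl⟩ : ∃ e ∈ (extChartAt I x).target, (extChartAt I x).symm e = p :=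
    ⟨_, (extChartAt I x).map_source hp, (extChartAt I x).left_inv hp⟩
  rw [(extChartAt I x).right_inv he]
  change g _ (chartSymmD I x e _) (chartSymmD I x e _) = _
  rw [chartSymmD_chartD he, chartSymmD_chartD he]

omit [IsManifold I ∞ M] [I.Boundaryless] in
lemma Metric.coordCov_symm (g : Metric I M) (x : M) (e u v : E) :
    coordCov I g.val x e u v = coordCov I g.val x e v u :=
  g.symm _ _ _

lemma Metric.coordCov_nondegenerate (g : Metric I M) {x : M} {e : E}
    (he : e ∈ (extChartAt I x).target) (u : E) (h : ∀ v, coordCov I g.val x e u v = 0) :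
    u = 0 := by
  have : chartSymmD I x e u = 0 := by
    refine g.nondegenerate _ _ fun v => ?_
    rw [← chartSymmD_chartD he v]
    exact h _
  rw [← chartD_chartSymmD he u, this, map_zero]

-- Nondegeneracy is injectivity into the dual, a space of the same finite dimension.
omit [IsManifold I ∞ M] [I.Boundaryless] in
lemma isInvertible_of_nondegenerate [FiniteDimensional ℝ E]
    (A : E →L[ℝ] E →L[ℝ] ℝ) (h : ∀ u, (∀ v, A u v = 0) → u = 0) : A.IsInvertible := by
  have hinj : Function.Injective (A : E →ₗ[ℝ] (E →L[ℝ] ℝ)) := by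
    rw [← LinearMap.ker_eq_bot, LinearMap.ker_eq_bot']
    intro u hu
    exact h u fun v => DFunLike.congr_fun hu v
  have hrank : Module.finrank ℝ E = Module.finrank ℝ (E →L[ℝ] ℝ) := by
    rw [← (LinearMap.toContinuousLinearMap : (E →ₗ[ℝ] ℝ) ≃ₗ[ℝ] _).finrank_eq]
    exact (Subspace.dual_finrank_eq (K := ℝ) (V := E)).symm
  refine ⟨(LinearEquiv.ofInjectiveOfFinrankEq _ hinj hrank).toContinuousLinearEquiv, ?_⟩
  ext u v
  rfl

section FiniteDimensional

variable [FiniteDimensional ℝ E]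

lemma Metric.coordCov_isInvertible (g : Metric I M) {x : M} {e : E}
    (he : e ∈ (extChartAt I x).target) : (coordCov I g.val x e).IsInvertible :=
  isInvertible_of_nondegenerate _ (g.coordCov_nondegenerate he)

omit [IsManifold I ∞ M] [I.Boundaryless] in
lemma Metric.val_contra (g : Metric I M) (p : M) (α : TangentSpace I p →L[ℝ] ℝ) :
    g.val p (g.contra p α) = α :=
  (isInvertible_of_nondegenerate (E := E) (g.val p) (g.nondegenerate p)).self_apply_inverse α

lemma Metric.coordCov_coordContra_contra (g : Metric I M) {x : M} {e : E}
    (he : e ∈ (extChartAt I x).target) (ξ : E →L[ℝ] ℝ) :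
    coordCov I g.val x e (coordContra I g.contra x e ξ) = ξ := by
  ext v
  change g.val _ (chartSymmD I x e (chartD I x _ (g.contra _ (ξ.comp _)))) (chartSymmD I x e v) = _
  rw [chartSymmD_chartD he, g.val_contra]
  change ξ (chartD I x _ (chartSymmD I x e v)) = _
  rw [chartD_chartSymmD he]

lemma Metric.coordContra_contra (g : Metric I M) {x : M} {e : E}
    (he : e ∈ (extChartAt I x).target) (ξ : E →L[ℝ] ℝ) :
    coordContra I g.contra x e ξ = (coordCov I g.val x e).inverse ξ := by
  rw [eq_comm, (g.coordCov_isInvertible he).inverse_apply_eq, g.coordCov_coordContra_contra he]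

/-- Christoffel symbols of coordinate vector fields, with the upper index lowered. -/
lemma Metric.val_covDeriv_coordField (g : Metric I M) (x : M) (u v w : E) :
    g.val x (g.covDeriv (coordField I x u) (coordField I x v) x) (coordField I x w x) =
      (1 / 2 : ℝ) * (fderiv ℝ (coordCov I g.val x) (extChartAt I x x) u v w
        + fderiv ℝ (coordCov I g.val x) (extChartAt I x x) v u w
        - fderiv ℝ (coordCov I g.val x) (extChartAt I x x) w u v) := by
  have hx := mem_extChartAt_source (I := I) x
  rw [← coordCov_chartD g.val hx, Metric.covDeriv, (chartD_isInvertible hx).self_apply_inverse,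
    chartD_coordField hx, chartD_coordField hx, chartD_coordField hx, fderiv_coordVec_coordField,
    zero_apply, zero_add, Metric.christoffel,
    (g.coordCov_isInvertible (mem_extChartAt_target x)).self_apply_inverse]
  rfl

end FiniteDimensional

lemma coordForm_endo (g : Metric I M)
    (K : ∀ p : M, (TangentSpace I p →L[ℝ] ℝ) →L[ℝ] TangentSpace I p)
    (η : ∀ p : M, TangentSpace I p →L[ℝ] ℝ) {x : M} {e : E} (he : e ∈ (extChartAt I x).target) :
    coordForm I (fun p => g.val p (K p (η p))) x e =
      coordCov I g.val x e (coordContra I K x e (coordForm I η x e)) := by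
  have hη : (coordForm I η x e).comp (chartD I x ((extChartAt I x).symm e)) =
      η ((extChartAt I x).symm e) := by
    ext w
    exact congrArg _ (chartSymmD_chartD he w)
  ext v
  change _ = g.val _ (chartSymmD I x e (chartD I x _ (K _ ((coordForm I η x e).comp
    (chartD I x ((extChartAt I x).symm e)))))) (chartSymmD I x e v)
  rw [chartSymmD_chartD he, hη]
  rfl

omit [IsManifold I ∞ M] [I.Boundaryless] in
lemma SymTensor.coordContra_symm (K : SymTensor I M) (x : M) (e : E) (α β : E →L[ℝ] ℝ) :
    β (coordContra I K.val x e α) = α (coordContra I K.val x e β) :=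
  K.symm _ (α.comp (chartD I x ((extChartAt I x).symm e)))
    (β.comp (chartD I x ((extChartAt I x).symm e)))

lemma coordForm_diff {V : M → ℝ} (hV : ContMDiff I 𝓘(ℝ, ℝ) ∞ V) {x : M} {e : E}
    (he : e ∈ (extChartAt I x).target) :
    coordForm I (diff I V) x e = fderiv ℝ (V ∘ (extChartAt I x).symm) e := by
  rw [← mfderiv_eq_fderiv, mfderiv_comp e (I' := I)
    (hV.mdifferentiableAt (by simp)) (mdifferentiableAt_symm he)]
  rfl

omit [I.Boundaryless] in
lemma contDiffOn_comp_symm {V : M → ℝ} (hV : ContMDiff I 𝓘(ℝ, ℝ) ∞ V) (x : M) :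
    ContDiffOn ℝ ∞ (V ∘ (extChartAt I x).symm) (extChartAt I x).target :=
  contMDiffOn_iff_contDiffOn.1 (hV.comp_contMDiffOn (contMDiffOn_extChartAt_symm x))

lemma contDiffOn_coordForm_diff {V : M → ℝ} (hV : ContMDiff I 𝓘(ℝ, ℝ) ∞ V) (x : M) :
    ContDiffOn ℝ ∞ (coordForm I (diff I V) x) (extChartAt I x).target :=
  ((contDiffOn_comp_symm hV x).fderiv_of_isOpen (isOpen_extChartAt_target x) (m := ∞)
    (by simp)).congr fun _ he => coordForm_diff hV he

lemma contDiffOn_coordForm_endo (g : Metric I M) (K : SymTensor I M) {V : M → ℝ}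
    (hV : ContMDiff I 𝓘(ℝ, ℝ) ∞ V) (x : M) :
    ContDiffOn ℝ ∞ (coordForm I (fun p => g.val p (K.val p (diff I V p))) x)
      (extChartAt I x).target :=
  ((g.smooth x).clm_apply ((K.smooth x).clm_apply (contDiffOn_coordForm_diff hV x))).congr
    fun _ he => coordForm_endo g K.val _ he

/-- The components, in the chart at `x`, of the endomorphism of the tangent bundle given by `K`. -/
def coordEndo (g : Metric I M) (K : SymTensor I M) (x : M) (e : E) : E →L[ℝ] E :=
  (coordContra I K.val x e).comp (coordCov I g.val x e)

omit [IsManifold I ∞ M] [I.Boundaryless] in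
lemma contDiffOn_coordEndo (g : Metric I M) (K : SymTensor I M) (x : M) :
    ContDiffOn ℝ ∞ (coordEndo g K x) (extChartAt I x).target :=
  (K.smooth x).clm_comp (g.smooth x)

lemma coordEndo_apply (g : Metric I M) (K : SymTensor I M) {x : M} {e : E}
    (he : e ∈ (extChartAt I x).target) (w : E) :
    coordEndo g K x e w = chartD I x _ (g.endo K ((extChartAt I x).symm e) (chartSymmD I x e w)) := by
  have h : (coordCov I g.val x e w).comp (chartD I x ((extChartAt I x).symm e)) =
      g.val _ (chartSymmD I x e w) := by
    ext v
    exact congrArg (g.val _ (chartSymmD I x e w)) (chartSymmD_chartD he v)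
  change chartD I x _ (K.val _ ((coordCov I g.val x e w).comp _)) = _
  rw [h]
  rfl

/-- By the symmetry of $g$ and $K$, the action on one-forms is the transpose of the action on
vectors. Computations can therefore use the eigenvectors of `coordEndo`. -/
lemma coordForm_endo_apply (g : Metric I M) (K : SymTensor I M)
    (η : ∀ p : M, TangentSpace I p →L[ℝ] ℝ) {x : M} {e : E} (he : e ∈ (extChartAt I x).target)
    (w : E) :
    coordForm I (fun p => g.val p (K.val p (η p))) x e w =
      coordForm I η x e (coordEndo g K x e w) := by
  rw [coordForm_endo g K.val η he, g.coordCov_symm, K.coordContra_symm]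
  rfl

omit [IsManifold I ∞ M] in
lemma differentiableAt_of_contDiffOn {F : Type*} [NormedAddCommGroup F] [NormedSpace ℝ F]
    {f : E → F} {x : M} (hf : ContDiffOn ℝ ∞ f (extChartAt I x).target) :
    DifferentiableAt ℝ f (extChartAt I x x) :=
  (hf.contDiffAt (target_mem_nhds (mem_extChartAt_target x))).differentiableAt (by simp)

/-! ### The Killing equation in coordinates -/

/-- The Killing equation in terms of the components `A` of the metric and `D` of the endomorphism
given by the tensor: `(∂_{DX} A)(X, X) + A(X, (∂_X D) X) = (∂_X A)(X, DX)`. -/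
lemma IsKillingTensor.coord_eq [FiniteDimensional ℝ E] {g : Metric I M} {K : SymTensor I M}
    (hK : IsKillingTensor g K) (x : M) (X : E) :
    fderiv ℝ (coordCov I g.val x) (extChartAt I x x) (coordEndo g K x (extChartAt I x x) X) X X
      + coordCov I g.val x (extChartAt I x x) X
          (fderiv ℝ (coordEndo g K x) (extChartAt I x x) X X) =
    fderiv ℝ (coordCov I g.val x) (extChartAt I x x) X X
      (coordEndo g K x (extChartAt I x x) X) := by
  have he := mem_extChartAt_target (I := I) x
  have hT := target_mem_nhds he
  set e₀ := extChartAt I x x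
  set A := coordCov I g.val x with hA
  set D := coordEndo g K x
  set ξ := A e₀ X
  -- The Schouten bracket differentiates with the covector `ξ` held constant. Its metric dual `b`
  -- then varies, with value `X` at the centre.
  set b : E → E := fun e => coordContra I g.contra x e ξ with hb
  have hbX : b e₀ = X := by
    rw [hb]; simp only
    rw [g.coordContra_contra he]
    exact (g.coordCov_isInvertible he).inverse_apply_self X
  have hAd : HasFDerivAt A (fderiv ℝ A e₀) e₀ :=
    (differentiableAt_of_contDiffOn (g.smooth x)).hasFDerivAt
  have hDd : HasFDerivAt D (fderiv ℝ D e₀) e₀ :=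
    (differentiableAt_of_contDiffOn (contDiffOn_coordEndo g K x)).hasFDerivAt
  have hbd : HasFDerivAt b (fderiv ℝ b e₀) e₀ := by
    have : CompleteSpace E := FiniteDimensional.complete ℝ E
    refine DifferentiableAt.hasFDerivAt ?_
    have hev : b =ᶠ[𝓝 e₀] fun e => (A e).inverse ξ := by
      filter_upwards [hT] with e he'
      exact g.coordContra_contra he' ξ
    refine DifferentiableAt.congr_of_eventuallyEq ?_ hev
    obtain ⟨A₀, hA₀⟩ := g.coordCov_isInvertible he
    have hinv : ContDiffAt ℝ ∞ ContinuousLinearMap.inverse (A e₀) := by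
      rw [hA, ← hA₀]; exact contDiffAt_map_inverse A₀
    exact ((hinv.differentiableAt (by simp)).comp e₀ hAd.differentiableAt).clm_apply
      (differentiableAt_const _)
  -- Differentiating the constant $A(e)\,b(e)=\xi$ expresses the derivative of the inverse metric
  -- through that of the metric.
  have hAb : ∀ Y, A e₀ (fderiv ℝ b e₀ Y) = - fderiv ℝ A e₀ Y X := by
    intro Y
    have h1 := hAd.clm_apply hbd
    have h2 : (fun e => A e (b e)) =ᶠ[𝓝 e₀] fun _ => ξ := by
      filter_upwards [hT] with e he'
      exact g.coordCov_coordContra_contra he' ξ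
    have h3 := (h1.congr_of_eventuallyEq h2.symm).unique (hasFDerivAt_const ξ e₀)
    have h4 := DFunLike.congr_fun h3 Y
    simp [hbX] at h4
    exact eq_neg_of_add_eq_zero_left h4
  have hself : ∀ u v, A e₀ u (D e₀ v) = A e₀ v (D e₀ u) := fun u v => K.coordContra_symm x e₀ _ _
  have hG : fderiv ℝ (fun e => ξ (b e)) e₀ (D e₀ X) = - fderiv ℝ A e₀ (D e₀ X) X X := by
    have h1 : HasFDerivAt (fun e => ξ (b e)) (ξ.comp (fderiv ℝ b e₀)) e₀ :=
      ξ.hasFDerivAt.comp e₀ hbd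
    rw [h1.fderiv]
    change A e₀ X (fderiv ℝ b e₀ _) = _
    rw [g.coordCov_symm]
    change A e₀ (fderiv ℝ b e₀ _) X = _
    rw [hAb]; rfl
  have hC : fderiv ℝ (fun e => ξ (coordContra I K.val x e ξ)) e₀ X =
      A e₀ X (fderiv ℝ D e₀ X X) - fderiv ℝ A e₀ X X (D e₀ X) := by
    -- Since $\xi = A(e)\,b(e)$ near the centre, the contravariant tensor applied to `ξ` is the
    -- endomorphism `D` applied to `b`.
    have hev : (fun e => ξ (coordContra I K.val x e ξ)) =ᶠ[𝓝 e₀] fun e => ξ (D e (b e)) := by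
      filter_upwards [hT] with e he'
      have h := g.coordCov_coordContra_contra he' ξ
      change _ = ξ (coordContra I K.val x e (coordCov I g.val x e (b e)))
      rw [h]
    have h1 : HasFDerivAt (fun e => ξ (D e (b e))) (ξ.comp _) e₀ :=
      ξ.hasFDerivAt.comp e₀ (hDd.clm_apply hbd)
    rw [hev.fderiv_eq, h1.fderiv]
    change A e₀ X (D e₀ (fderiv ℝ b e₀ X) + fderiv ℝ D e₀ X (b e₀)) = _
    rw [map_add, hself, hAb, hbX, neg_apply]
    ring
  have h := hK x ξ
  unfold schouten at h
  have hCX : coordContra I K.val x e₀ ξ = D e₀ X := rfl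
  change 2 * fderiv ℝ (fun e => ξ (b e)) e₀ (coordContra I K.val x e₀ ξ)
    - 2 * fderiv ℝ (fun e => ξ (coordContra I K.val x e ξ)) e₀ (b e₀) = 0 at h
  rw [hCX, hbX, hG, hC] at h
  linarith

end Charts

/-! ### Derivatives on boundaryless manifolds and constancy of functions -/

lemma hasMFDerivAt_iff_of_boundaryless {E H M E' H' M' : Type*}
    [NormedAddCommGroup E] [NormedSpace ℝ E] [TopologicalSpace H] {I : ModelWithCorners ℝ E H}
    [I.Boundaryless] [TopologicalSpace M] [ChartedSpace H M]
    [NormedAddCommGroup E'] [NormedSpace ℝ E'] [TopologicalSpace H'] {I' : ModelWithCorners ℝ E' H'}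
    [TopologicalSpace M'] [ChartedSpace H' M'] {f : M → M'} {x : M} (L : E →L[ℝ] E') :
    HasMFDerivAt I I' f x L ↔ ContinuousAt f x ∧
      HasFDerivAt (writtenInExtChartAt I I' x f) L (extChartAt I x x) := by
  rw [← hasFDerivWithinAt_univ, ← I.range_eq_univ]
  rfl

/-- On a ball inside a chart target a zero derivative forces constancy, so `f` is locally constant;
connectedness does the rest. -/
lemma apply_eq_of_hasMFDerivAt_zero {E : Type*} [NormedAddCommGroup E] [NormedSpace ℝ E]
    {M : Type*} [TopologicalSpace M] [ChartedSpace E M] [IsManifold 𝓘(ℝ, E) ∞ M]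
    [PreconnectedSpace M] {f : M → ℝ}
    (hf : ∀ q, HasMFDerivAt 𝓘(ℝ, E) 𝓘(ℝ, ℝ) f q (0 : E →L[ℝ] ℝ)) (q q' : M) : f q = f q' := by
  have hloc : IsLocallyConstant f := by
    rw [IsLocallyConstant.iff_eventually_eq]
    intro x
    have hx := mem_extChartAt_target (I := 𝓘(ℝ, E)) x
    obtain ⟨r, hr, hball⟩ := Metric.isOpen_iff.1 (isOpen_extChartAt_target (I := 𝓘(ℝ, E)) x) _ hx
    have hder : ∀ e ∈ (extChartAt 𝓘(ℝ, E) x).target,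
        HasFDerivAt (f ∘ (extChartAt 𝓘(ℝ, E) x).symm) (0 : E →L[ℝ] ℝ) e := by
      intro e he
      have h := (hf _).comp e (mdifferentiableAt_symm he).hasMFDerivAt
      rw [hasMFDerivAt_iff_hasFDerivAt] at h
      exact h.congr_fderiv (ContinuousLinearMap.zero_comp _)
    filter_upwards [(continuousAt_extChartAt (I := 𝓘(ℝ, E)) x).preimage_mem_nhds
      (Metric.ball_mem_nhds _ hr), extChartAt_source_mem_nhds (I := 𝓘(ℝ, E)) x] with y hy hys
    have h := Metric.isOpen_ball.is_const_of_fderiv_eq_zero (𝕜 := ℝ)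
      (convex_ball _ r).isPreconnected
      (fun e he => (hder e (hball he)).differentiableAt.differentiableWithinAt)
      (fun e he => (hder e (hball he)).fderiv) hy (Metric.mem_ball_self hr)
    simp only [Function.comp_apply] at h
    rwa [(extChartAt 𝓘(ℝ, E) x).left_inv hys, extChartAt_to_inv] at h
  exact hloc.apply_eq_of_preconnectedSpace q q'

/-! ### Product charts and leaf embeddings -/

section Product

variable {ι : Type*} [Fintype ι]
  {E : ι → Type*} [∀ j, NormedAddCommGroup (E j)] [∀ j, NormedSpace ℝ (E j)]
  {M : ι → Type*} [∀ j, TopologicalSpace (M j)] [∀ j, ChartedSpace (E j) (M j)]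

instance prodModel_boundaryless : (prodModel E).Boundaryless where
  range_eq_univ := by
    refine eq_univ_of_forall fun e => ⟨e, ?_⟩
    rfl

lemma extChartAt_pi_symm_apply (x : ∀ j, M j) (e : ∀ j, E j) (j : ι) :
    (extChartAt (prodModel E) x).symm e j = (extChartAt 𝓘(ℝ, E j) (x j)).symm (e j) :=
  rfl

lemma mem_extChartAt_pi_source {x p : ∀ j, M j} :
    p ∈ (extChartAt (prodModel E) x).source ↔
      ∀ j, p j ∈ (extChartAt 𝓘(ℝ, E j) (x j)).source := by
  simp only [extChartAt_source]
  exact Set.mem_univ_pi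

lemma mem_extChartAt_pi_target {x : ∀ j, M j} {e : ∀ j, E j} :
    e ∈ (extChartAt (prodModel E) x).target ↔
      ∀ j, e j ∈ (extChartAt 𝓘(ℝ, E j) (x j)).target := by
  simp only [extChartAt_target]
  rw [ModelWithCorners.range_eq_univ, inter_univ]
  simp only [mem_inter_iff, ModelWithCorners.range_eq_univ, mem_univ, and_true]
  exact Set.mem_univ_pi

section Leaf

variable [DecidableEq ι]

omit [Fintype ι] [∀ j, TopologicalSpace (M j)] [∀ j, ChartedSpace (E j) (M j)] in
lemma hasFDerivAt_update_single (e : ∀ j, E j) (i : ι) (y : E i) :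
    HasFDerivAt (Function.update e i) (ContinuousLinearMap.single ℝ E i) y := by
  refine (hasFDerivAt_update e y).congr_fderiv ?_
  ext v k
  by_cases hk : k = i
  · subst hk; simp
  · simp [hk]

lemma writtenInExtChartAt_leafMap (p : ∀ j, M j) (i : ι) (q : M i) :
    writtenInExtChartAt 𝓘(ℝ, E i) (prodModel E) q (leafMap p i)
      =ᶠ[𝓝 (extChartAt 𝓘(ℝ, E i) q q)] Function.update (extChartAt (prodModel E) p p) i := by
  filter_upwards [target_mem_nhds (mem_extChartAt_target (I := 𝓘(ℝ, E i)) q)] with e he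
  funext j
  change extChartAt 𝓘(ℝ, E j) (Function.update p i q j)
    (Function.update p i ((extChartAt 𝓘(ℝ, E i) q).symm e) j) = _
  by_cases hj : j = i
  · subst hj
    rw [Function.update_self, Function.update_self, Function.update_self,
      PartialEquiv.right_inv _ he]
  · rw [Function.update_of_ne hj, Function.update_of_ne hj, Function.update_of_ne hj]
    rfl

lemma hasMFDerivAt_leafMap (p : ∀ j, M j) (i : ι) (q : M i) :
    HasMFDerivAt 𝓘(ℝ, E i) (prodModel E) (leafMap p i) q
      (ContinuousLinearMap.single ℝ E i) :=
  (hasMFDerivAt_iff_of_boundaryless _).2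
    ⟨(continuous_const.update i continuous_id).continuousAt,
      (hasFDerivAt_update_single _ i _).congr_of_eventuallyEq (writtenInExtChartAt_leafMap p i q)⟩

lemma contMDiff_leafMap (p : ∀ j, M j) (i : ι) :
    ContMDiff 𝓘(ℝ, E i) (prodModel E) ∞ (leafMap p i) := by
  intro q
  refine contMDiffAt_iff.2 ⟨(continuous_const.update i continuous_id).continuousAt, ?_⟩
  rw [ModelWithCorners.range_eq_univ, contDiffWithinAt_univ]
  exact (contDiff_update ∞ _ i).contDiffAt.congr_of_eventuallyEq
    (writtenInExtChartAt_leafMap p i q)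

lemma leafMapD_eq (p : ∀ j, M j) (i : ι) (q : M i) :
    leafMapD E p i q = (ContinuousLinearMap.single ℝ E i : E i →L[ℝ] ∀ j, E j) :=
  (hasMFDerivAt_leafMap p i q).mfderiv

lemma factorIncl_apply (p : ∀ j, M j) (i : ι) (v : E i) :
    factorIncl E p i v = (Pi.single i v : ∀ j, E j) := by
  rw [factorIncl, leafMapD_eq]; rfl

lemma leafMapD_apply (p : ∀ j, M j) (i : ι) (q : M i) (v : E i) :
    leafMapD E p i q v = (Pi.single i v : ∀ j, E j) := by
  rw [leafMapD_eq]; rfl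

lemma mem_productNet {i : ι} {p : ∀ j, M j} {w : TangentSpace (prodModel E) p} :
    w ∈ productNet E i p ↔ ∃ v : E i, (Pi.single i v : ∀ j, E j) = w := by
  constructor
  · rintro ⟨v, hv⟩
    exact ⟨v, (factorIncl_apply p i v).symm.trans hv⟩
  · rintro ⟨v, hv⟩
    exact ⟨v, (factorIncl_apply p i v).trans hv⟩

end Leaf

variable [∀ j, IsManifold 𝓘(ℝ, E j) ∞ (M j)]

/-- Transition maps of product charts act factor by factor, so smoothness is checked one component
at a time. -/
instance isManifold_pi : IsManifold (prodModel E) ∞ (∀ j, M j) := by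
  refine isManifold_of_contDiffOn _ _ _ ?_
  rintro _ _ ⟨e, he, rfl⟩ ⟨e', he', rfl⟩
  rw [contDiffOn_pi]
  intro j
  have h := (contDiffGroupoid ∞ 𝓘(ℝ, E j)).compatible (he j (mem_univ j)) (he' j (mem_univ j))
  rw [contDiffGroupoid, mem_groupoid_of_pregroupoid] at h
  have h1 : ContDiffOn ℝ ∞ (𝓘(ℝ, E j) ∘ ((e j).symm ≫ₕ e' j) ∘ 𝓘(ℝ, E j).symm)
    (𝓘(ℝ, E j).symm ⁻¹' ((e j).symm ≫ₕ e' j).source ∩ range 𝓘(ℝ, E j)) := h.1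
  refine h1.comp (ContinuousLinearMap.proj (R := ℝ) (φ := E) j).contDiff.contDiffOn ?_
  rintro v ⟨hv, -⟩
  refine ⟨?_, by simp⟩
  exact ⟨hv.1 j (mem_univ j), hv.2 j (mem_univ j)⟩

lemma chartD_pi_apply {x p : ∀ j, M j} (hp : p ∈ (extChartAt (prodModel E) x).source)
    (w : ∀ j, E j) (j : ι) :
    (chartD (prodModel E) x p w : ∀ j, E j) j = chartD 𝓘(ℝ, E j) (x j) (p j) (w j) := by
  have hj : ∀ j, HasMFDerivAt 𝓘(ℝ, E j) 𝓘(ℝ, E j) (extChartAt 𝓘(ℝ, E j) (x j)) (p j)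
      (chartD 𝓘(ℝ, E j) (x j) (p j)) := fun j =>
    (mdifferentiableAt_extChartAt (by
      rw [← extChartAt_source 𝓘(ℝ, E j)]; exact mem_extChartAt_pi_source.1 hp j)).hasMFDerivAt
  let L : (∀ j, E j) →L[ℝ] (∀ j, E j) := ContinuousLinearMap.pi fun j =>
    ContinuousLinearMap.comp (chartD 𝓘(ℝ, E j) (x j) (p j) : E j →L[ℝ] E j)
      (ContinuousLinearMap.proj j)
  have h : HasMFDerivAt (prodModel E) 𝓘(ℝ, ∀ j, E j) (extChartAt (prodModel E) x) p L := by
    refine (hasMFDerivAt_iff_of_boundaryless L).2 ⟨continuousAt_extChartAt' hp, ?_⟩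
    rw [hasFDerivAt_pi]
    intro j
    have h1 := ((hasMFDerivAt_iff_of_boundaryless _).1 (hj j)).2
    exact HasFDerivAt.comp (extChartAt (prodModel E) p p) (f := fun e : ∀ j, E j => e j) h1
      (ContinuousLinearMap.proj (R := ℝ) (φ := E) j).hasFDerivAt
  exact congrFun (DFunLike.congr_fun h.mfderiv w) j

/-- Obtained from `chartD_pi_apply` by inverting the chart differential on each factor. -/
lemma chartSymmD_pi_apply {x : ∀ j, M j} {e : ∀ j, E j}
    (he : e ∈ (extChartAt (prodModel E) x).target) (w : ∀ j, E j) (j : ι) :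
    (chartSymmD (prodModel E) x e w : ∀ j, E j) j = chartSymmD 𝓘(ℝ, E j) (x j) (e j) (w j) := by
  have hp := (extChartAt (prodModel E) x).map_target he
  have h1 := (chartD_pi_apply hp (chartSymmD (prodModel E) x e w) j).symm.trans
    (congrFun (chartD_chartSymmD he w) j)
  have h2 := chartSymmD_chartD (mem_extChartAt_pi_target.1 he j)
    ((chartSymmD (prodModel E) x e w : ∀ j, E j) j)
  rw [← h2]
  exact congrArg _ h1

variable [DecidableEq ι]

lemma chartSymmD_single {x : ∀ j, M j} {e : ∀ j, E j}
    (he : e ∈ (extChartAt (prodModel E) x).target) (i : ι) (v : E i) :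
    chartSymmD (prodModel E) x e (Pi.single i v : ∀ j, E j) =
      (Pi.single i (chartSymmD 𝓘(ℝ, E i) (x i) (e i) v : E i) : ∀ j, E j) := by
  funext j
  refine (chartSymmD_pi_apply he _ j).trans ?_
  by_cases hj : j = i
  · subst hj
    rw [Pi.single_eq_same]
    exact (Pi.single_eq_same (M := E) j _).symm
  · rw [Pi.single_eq_of_ne hj]
    exact (map_zero _).trans (Pi.single_eq_of_ne (M := E) hj _).symm

lemma chartSymmD_single_mem {x : ∀ j, M j} {e : ∀ j, E j}
    (he : e ∈ (extChartAt (prodModel E) x).target) (i : ι) (v : E i) :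
    chartSymmD (prodModel E) x e (Pi.single i v : ∀ j, E j) ∈
      productNet E i ((extChartAt (prodModel E) x).symm e) :=
  mem_productNet.2 ⟨_, (chartSymmD_single he i v).symm⟩

end Product

/-! ### The product net of eigenspaces -/

section Net

variable {ι : Type*} [Fintype ι] [DecidableEq ι]
  {E : ι → Type*} [∀ j, NormedAddCommGroup (E j)] [∀ j, NormedSpace ℝ (E j)]
  {M : ι → Type*} [∀ j, TopologicalSpace (M j)] [∀ j, ChartedSpace (E j) (M j)]
  {g : Metric (prodModel E) (∀ j, M j)} {K : SymTensor (prodModel E) (∀ j, M j)}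
  {lam : ι → (∀ j, M j) → ℝ}

/-- Equal eigenvalues would identify two eigenspaces, but distinct factors give nonzero subspaces
meeting only in zero. -/
lemma eigenvalue_ne [∀ j, Nontrivial (E j)]
    (hnet : ∀ j p, Module.End.eigenspace (g.endo K p) (lam j p) = productNet E j p)
    {a b : ι} (hab : a ≠ b) (p : ∀ j, M j) : lam a p ≠ lam b p := by
  intro h
  obtain ⟨v, hv⟩ := exists_ne (0 : E a)
  have h1 : productNet E a p = productNet E b p := by rw [← hnet, ← hnet, h]
  have h2 : ((Pi.single a v : ∀ j, E j) : TangentSpace (prodModel E) p) ∈ productNet E a p :=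
    mem_productNet.2 ⟨v, rfl⟩
  rw [h1] at h2
  obtain ⟨v', hv'⟩ := mem_productNet.1 h2
  have h3 : (Pi.single b v' : ∀ j, E j) a = (Pi.single a v : ∀ j, E j) a := congrFun hv' a
  rw [Pi.single_eq_same, Pi.single_eq_of_ne hab] at h3
  exact hv h3.symm

/-- The usual argument for a self-adjoint endomorphism: $(\lambda_a-\lambda_b)\,g(u,v)=0$. It needs
no definiteness of $g$. -/
lemma productNet_orthogonal [∀ j, Nontrivial (E j)]
    (hnet : ∀ j p, Module.End.eigenspace (g.endo K p) (lam j p) = productNet E j p)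
    {a b : ι} (hab : a ≠ b) {p : ∀ j, M j} {u v : TangentSpace (prodModel E) p}
    (hu : u ∈ productNet E a p) (hv : v ∈ productNet E b p) : g.val p u v = 0 := by
  rw [← hnet, Module.End.mem_eigenspace_iff] at hu hv
  have hu' : K.val p (g.val p u) = lam a p • u := hu
  have hv' : K.val p (g.val p v) = lam b p • v := hv
  have h := K.symm p (g.val p u) (g.val p v)
  rw [hu', hv', map_smul, map_smul, g.symm p v u, smul_eq_mul, smul_eq_mul] at h
  have h2 : (lam a p - lam b p) * g.val p u v = 0 := by linear_combination h
  exact (mul_eq_zero.1 h2).resolve_left (sub_ne_zero.2 (eigenvalue_ne hnet hab p))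

lemma productNet_le_orth [∀ j, Nontrivial (E j)]
    (hnet : ∀ j p, Module.End.eigenspace (g.endo K p) (lam j p) = productNet E j p)
    {a b : ι} (hab : a ≠ b) (p : ∀ j, M j) : productNet E a p ≤ g.orth (productNet E b) p :=
  fun _ hu _ hv => productNet_orthogonal hnet hab hu hv

lemma chartD_factorIncl [∀ j, IsManifold 𝓘(ℝ, E j) ∞ (M j)] {x p : ∀ j, M j}
    (hp : p ∈ (extChartAt (prodModel E) x).source) (i : ι) (v : E i) :
    chartD (prodModel E) x p (factorIncl E p i v) =
      (Pi.single i (chartD 𝓘(ℝ, E i) (x i) (p i) v) : ∀ j, E j) := by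
  rw [factorIncl_apply]
  funext j
  refine (chartD_pi_apply hp _ j).trans ?_
  by_cases hj : j = i
  · subst hj
    rw [Pi.single_eq_same, Pi.single_eq_same]
  · rw [Pi.single_eq_of_ne hj, Pi.single_eq_of_ne hj]
    exact map_zero _

/-- The point is that `e` enters the right-hand side only through `e i`: the lift has constant
components along the other factors. -/
lemma coordContra_liftTensor [∀ j, IsManifold 𝓘(ℝ, E j) ∞ (M j)] (i : ι)
    (Ki : SymTensor 𝓘(ℝ, E i) (M i)) {x : ∀ j, M j} {e : ∀ j, E j}
    (he : e ∈ (extChartAt (prodModel E) x).target) (α : (∀ j, E j) →L[ℝ] ℝ) :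
    coordContra (prodModel E) (liftTensor i Ki) x e α =
      ContinuousLinearMap.single ℝ E i (coordContra 𝓘(ℝ, E i) Ki.val (x i) (e i)
        (α.comp (ContinuousLinearMap.single ℝ E i))) := by
  have hp := (extChartAt (prodModel E) x).map_target he
  refine (chartD_factorIncl hp i _).trans ?_
  refine congrArg (Pi.single (M := E) i) ?_
  have h : (α.comp (chartD (prodModel E) x ((extChartAt (prodModel E) x).symm e))).comp
        (factorIncl E ((extChartAt (prodModel E) x).symm e) i) =
      (α.comp (ContinuousLinearMap.single ℝ E i)).comp
        (chartD 𝓘(ℝ, E i) (x i) ((extChartAt (prodModel E) x).symm e i)) := by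
    ext v
    exact congrArg α (chartD_factorIncl hp i v)
  change chartD 𝓘(ℝ, E i) (x i) ((extChartAt (prodModel E) x).symm e i)
    (Ki.val ((extChartAt (prodModel E) x).symm e i) ((α.comp (chartD (prodModel E) x
      ((extChartAt (prodModel E) x).symm e))).comp
        (factorIncl E ((extChartAt (prodModel E) x).symm e) i))) = _
  rw [h]
  rfl

lemma coordField_single_mem [∀ j, IsManifold 𝓘(ℝ, E j) ∞ (M j)] {x p : ∀ j, M j}
    (hp : p ∈ (extChartAt (prodModel E) x).source) (i : ι) (v : E i) :
    coordField (prodModel E) x (Pi.single i v : ∀ j, E j) p ∈ productNet E i p := by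
  obtain ⟨e, he, rfl⟩ : ∃ e ∈ (extChartAt (prodModel E) x).target,
      (extChartAt (prodModel E) x).symm e = p :=
    ⟨_, (extChartAt _ x).map_source hp, (extChartAt _ x).left_inv hp⟩
  rw [coordField_symm he]
  exact chartSymmD_single_mem he i v

lemma isSectionOn_coordField_single [∀ j, IsManifold 𝓘(ℝ, E j) ∞ (M j)] (x : ∀ j, M j) (i : ι)
    (v : E i) :
    IsSectionOn (productNet E i) (extChartAt (prodModel E) x).source
      (coordField (prodModel E) x (Pi.single i v : ∀ j, E j)) :=
  ⟨smoothVecOn_coordField _ _, fun _ hp => coordField_single_mem hp i v⟩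

omit [DecidableEq ι] in
lemma val_coordField [∀ j, IsManifold 𝓘(ℝ, E j) ∞ (M j)] (g : Metric (prodModel E) (∀ j, M j))
    (x : ∀ j, M j) (u v : ∀ j, E j) :
    g.val x (coordField (prodModel E) x u x) (coordField (prodModel E) x v x) =
      coordCov (prodModel E) g.val x (extChartAt (prodModel E) x x) u v := by
  have hx := mem_extChartAt_source (I := prodModel E) x
  rw [← coordCov_chartD g.val hx, chartD_coordField hx, chartD_coordField hx]

variable [∀ j, Nontrivial (E j)] [∀ j, IsManifold 𝓘(ℝ, E j) ∞ (M j)]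

lemma coordCov_single_single
    (hnet : ∀ j p, Module.End.eigenspace (g.endo K p) (lam j p) = productNet E j p)
    {a b : ι} (hab : a ≠ b) {x : ∀ j, M j} {e : ∀ j, E j}
    (he : e ∈ (extChartAt (prodModel E) x).target) (u : E a) (v : E b) :
    coordCov (prodModel E) g.val x e (Pi.single a u) (Pi.single b v) = 0 :=
  productNet_orthogonal hnet hab (chartSymmD_single_mem he a u) (chartSymmD_single_mem he b v)

lemma fderiv_coordCov_single_single
    (hnet : ∀ j p, Module.End.eigenspace (g.endo K p) (lam j p) = productNet E j p)
    {a b : ι} (hab : a ≠ b) (x : ∀ j, M j) (Y : ∀ j, E j) (u : E a) (v : E b) :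
    fderiv ℝ (coordCov (prodModel E) g.val x) (extChartAt (prodModel E) x x) Y
      (Pi.single a u) (Pi.single b v) = 0 := by
  have he := mem_extChartAt_target (I := prodModel E) x
  have hA := (differentiableAt_of_contDiffOn (g.smooth x)).hasFDerivAt
  have h1 := (hA.clm_apply (hasFDerivAt_const (Pi.single a u : ∀ j, E j) _)).clm_apply
    (hasFDerivAt_const (Pi.single b v : ∀ j, E j) _)
  have h2 : (fun e => coordCov (prodModel E) g.val x e (Pi.single a u) (Pi.single b v))
      =ᶠ[𝓝 (extChartAt (prodModel E) x x)] fun _ => 0 := by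
    filter_upwards [target_mem_nhds he] with e he'
    exact coordCov_single_single hnet hab he' u v
  have h3 := (h1.congr_of_eventuallyEq h2.symm).unique (hasFDerivAt_const (0 : ℝ) _)
  simpa using DFunLike.congr_fun h3 Y

omit [∀ j, Nontrivial (E j)] in
lemma coordEndo_single
    (hnet : ∀ j p, Module.End.eigenspace (g.endo K p) (lam j p) = productNet E j p)
    {x : ∀ j, M j} {e : ∀ j, E j} (he : e ∈ (extChartAt (prodModel E) x).target) (a : ι) (u : E a) :
    coordEndo g K x e (Pi.single a u) =
      lam a ((extChartAt (prodModel E) x).symm e) • (Pi.single a u : ∀ j, E j) := by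
  have h := chartSymmD_single_mem he a u
  rw [← hnet, Module.End.mem_eigenspace_iff] at h
  rw [coordEndo_apply g K he, h, map_smul, chartD_chartSymmD he]

-- In a product chart the eigenvector `Pi.single a u` is constant, so differentiating the eigenvalue
-- equation produces no derivative of the eigenvector.
omit [∀ j, Nontrivial (E j)] in
lemma fderiv_coordEndo_single
    (hlam : ∀ j, ContMDiff (prodModel E) 𝓘(ℝ, ℝ) ∞ (lam j))
    (hnet : ∀ j p, Module.End.eigenspace (g.endo K p) (lam j p) = productNet E j p)
    (x : ∀ j, M j) (Y : ∀ j, E j) (a : ι) (u : E a) :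
    fderiv ℝ (coordEndo g K x) (extChartAt (prodModel E) x x) Y (Pi.single a u) =
      fderiv ℝ (lam a ∘ (extChartAt (prodModel E) x).symm) (extChartAt (prodModel E) x x) Y •
        (Pi.single a u : ∀ j, E j) := by
  have he := mem_extChartAt_target (I := prodModel E) x
  have hD := (differentiableAt_of_contDiffOn (contDiffOn_coordEndo g K x)).hasFDerivAt
  have hl := (differentiableAt_of_contDiffOn (contDiffOn_comp_symm (hlam a) x)).hasFDerivAt
  have h1 := hD.clm_apply (hasFDerivAt_const (Pi.single a u : ∀ j, E j) _)
  have h2 := hl.smul_const (Pi.single a u : ∀ j, E j)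
  have h3 : (fun e => coordEndo g K x e (Pi.single a u)) =ᶠ[𝓝 (extChartAt (prodModel E) x x)]
      fun e => (lam a ∘ (extChartAt (prodModel E) x).symm) e • (Pi.single a u : ∀ j, E j) := by
    filter_upwards [target_mem_nhds he] with e he'
    exact coordEndo_single hnet he' a u
  have h4 := (h1.congr_of_eventuallyEq h3.symm).unique h2
  simpa using DFunLike.congr_fun h4 Y

variable [∀ j, FiniteDimensional ℝ (E j)]

/-! ### Consequences of the Killing distribution for metric and eigenvalues -/

/-- If `E_i^⊥` is geodesic, the components of the metric on the other factors do not vary along the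
factor `M i`. -/
lemma fderiv_coordCov_of_isGeodesic
    (hnet : ∀ j p, Module.End.eigenspace (g.endo K p) (lam j p) = productNet E j p)
    {i j : ι} (hji : j ≠ i) (hgeo : IsGeodesic g (g.orth (productNet E i)))
    (x : ∀ j, M j) (u : E i) (z : E j) :
    fderiv ℝ (coordCov (prodModel E) g.val x) (extChartAt (prodModel E) x x) (Pi.single i u)
      (Pi.single j z) (Pi.single j z) = 0 := by
  have hx := mem_extChartAt_source (I := prodModel E) x
  have hsec : IsSectionOn (g.orth (productNet E i)) (extChartAt (prodModel E) x).source
      (coordField (prodModel E) x (Pi.single j z : ∀ j, E j)) :=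
    ⟨smoothVecOn_coordField _ _, fun p hp =>
      productNet_le_orth hnet hji p (coordField_single_mem hp j z)⟩
  -- Pairing $\nabla_z z\in E_i^\perp$ with $u\in E_i$: by block diagonality only
  -- $-\tfrac12\partial_u g(z,z)$ survives in the Koszul formula.
  have h := hgeo _ _ _ (isOpen_extChartAt_source x) hsec hsec x hx _
    (coordField_single_mem hx i u)
  rw [g.val_covDeriv_coordField, fderiv_coordCov_single_single hnet hji] at h
  linarith

/-- If `E_i` is umbilical, the components of the metric on `M i` vary conformally along the other
factors. -/
lemma exists_fderiv_coordCov_of_isSpherical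
    (hnet : ∀ j p, Module.End.eigenspace (g.endo K p) (lam j p) = productNet E j p)
    {i : ι} (hsph : IsSpherical g (productNet E i)) (x : ∀ j, M j) :
    ∃ θ : (∀ j, E j) → ℝ, ∀ j, j ≠ i → ∀ (z : E j) (u u' : E i),
      fderiv ℝ (coordCov (prodModel E) g.val x) (extChartAt (prodModel E) x x) (Pi.single j z)
        (Pi.single i u) (Pi.single i u') =
      -2 * θ (Pi.single j z) * coordCov (prodModel E) g.val x (extChartAt (prodModel E) x x)
        (Pi.single i u) (Pi.single i u') := by
  obtain ⟨N, -, humb, -⟩ := hsph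
  -- The witness is $\theta = g(N,\cdot)$; the factor $-2$ comes from $g(\nabla_u u',z) =
  -- -\tfrac12\partial_z g(u,u')$.
  refine ⟨fun w => g.val x (N x) (coordField (prodModel E) x w x), fun j hji z u u' => ?_⟩
  have hx := mem_extChartAt_source (I := prodModel E) x
  have h := humb _ _ _ (isOpen_extChartAt_source x) (isSectionOn_coordField_single x i u)
    (isSectionOn_coordField_single x i u') x hx _
    (productNet_le_orth hnet hji x (coordField_single_mem hx j z))
  rw [g.val_covDeriv_coordField, fderiv_coordCov_single_single hnet hji.symm,
    fderiv_coordCov_single_single hnet hji.symm, val_coordField] at h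
  linarith

-- If every vector of a block were null, polarisation and orthogonality to the other blocks would
-- put the block in the radical of $g$. Non-null vectors are what allows metric coefficients to be
-- cancelled in arbitrary signature.
omit [∀ j, FiniteDimensional ℝ (E j)] in
lemma exists_coordCov_single_self_ne_zero
    (hnet : ∀ j p, Module.End.eigenspace (g.endo K p) (lam j p) = productNet E j p)
    (i : ι) {x : ∀ j, M j} {e : ∀ j, E j} (he : e ∈ (extChartAt (prodModel E) x).target) :
    ∃ u : E i, coordCov (prodModel E) g.val x e (Pi.single i u) (Pi.single i u) ≠ 0 := by
  by_contra! h
  have h2 : ∀ u v : E i, coordCov (prodModel E) g.val x e (Pi.single i u) (Pi.single i v) = 0 := by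
    intro u v
    have h3 := h (u + v)
    simp only [Pi.single_add, map_add, add_apply] at h3
    rw [h u, h v, g.coordCov_symm x e (Pi.single i v)] at h3
    linarith
  obtain ⟨u, hu⟩ := exists_ne (0 : E i)
  refine hu ?_
  have h4 : (Pi.single i u : ∀ j, E j) = 0 := by
    refine g.coordCov_nondegenerate he _ fun w => ?_
    rw [← Finset.univ_sum_single w, map_sum]
    refine Finset.sum_eq_zero fun j _ => ?_
    by_cases hj : j = i
    · subst hj; exact h2 _ _
    · exact coordCov_single_single hnet (Ne.symm hj) he _ _
  simpa using congrFun h4 i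

/-- The Killing equation on sums of vectors tangent to two different factors. -/
lemma IsKillingTensor.fderiv_eigenvalue (hK : IsKillingTensor g K)
    (hlam : ∀ j, ContMDiff (prodModel E) 𝓘(ℝ, ℝ) ∞ (lam j))
    (hnet : ∀ j p, Module.End.eigenspace (g.endo K p) (lam j p) = productNet E j p)
    {i j : ι} (hji : j ≠ i) (hgeo : IsGeodesic g (g.orth (productNet E i))) (x : ∀ j, M j)
    (u : E i) (z : E j) :
    fderiv ℝ (lam j ∘ (extChartAt (prodModel E) x).symm) (extChartAt (prodModel E) x x)
        (Pi.single i u) *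
      coordCov (prodModel E) g.val x (extChartAt (prodModel E) x x)
        (Pi.single j z) (Pi.single j z) = 0 ∧
    fderiv ℝ (lam i ∘ (extChartAt (prodModel E) x).symm) (extChartAt (prodModel E) x x)
        (Pi.single j z) *
      coordCov (prodModel E) g.val x (extChartAt (prodModel E) x x)
        (Pi.single i u) (Pi.single i u) =
    (lam i x - lam j x) * fderiv ℝ (coordCov (prodModel E) g.val x) (extChartAt (prodModel E) x x)
      (Pi.single j z) (Pi.single i u) (Pi.single i u) := by
  have he := mem_extChartAt_target (I := prodModel E) x
  have hg := fderiv_coordCov_of_isGeodesic hnet hji hgeo x u z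
  have hA1 := coordCov_single_single hnet hji he z u
  have hA2 := coordCov_single_single hnet hji.symm he u z
  have hB1 : ∀ Y, _ := fun Y => fderiv_coordCov_single_single hnet hji x Y z u
  have hB2 : ∀ Y, _ := fun Y => fderiv_coordCov_single_single hnet hji.symm x Y u z
  have hDi := coordEndo_single hnet he i u
  have hDj := coordEndo_single hnet he j z
  have hdi : ∀ Y, _ := fun Y => fderiv_coordEndo_single hlam hnet x Y i u
  have hdj : ∀ Y, _ := fun Y => fderiv_coordEndo_single hlam hnet x Y j z
  rw [extChartAt_to_inv] at hDi hDj
  -- The equation is cubic. The half sum over $u\pm z$ minus the value at $u$ isolates the terms of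
  -- type $uzz$; the half difference minus the value at $z$ isolates those of type $uuz$.
  have h0 := hK.coord_eq x (Pi.single i u)
  have h1 := hK.coord_eq x (Pi.single i u + Pi.single j z)
  have h2 := hK.coord_eq x (Pi.single i u - Pi.single j z)
  have h3 := hK.coord_eq x (Pi.single j z)
  generalize (Pi.single i u : ∀ j, E j) = U at *
  generalize (Pi.single j z : ∀ j, E j) = Z at *
  simp only [map_add, map_sub, add_apply, sub_apply, smul_apply, map_smul, hDi, hDj, hdi, hdj, hA1,
    hA2, hB1, hB2, hg, smul_eq_mul] at h0 h1 h2 h3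
  constructor
  · linear_combination (1 / 2) * h1 + (1 / 2) * h2 - h0
  · linear_combination (1 / 2) * h1 - (1 / 2) * h2 - h3

end Net

/-! ### The closedness equation in coordinates -/

section Forms

variable {E : Type*} [NormedAddCommGroup E] [NormedSpace ℝ E]
  {H : Type*} [TopologicalSpace H] {I : ModelWithCorners ℝ E H} [I.Boundaryless]
  {M : Type*} [TopologicalSpace M] [ChartedSpace H M] [IsManifold I ∞ M]

/-- The second derivatives of a function in a chart are symmetric. -/
lemma fderiv_coordForm_diff_symm {V : M → ℝ} (hV : ContMDiff I 𝓘(ℝ, ℝ) ∞ V) (x : M) (u v : E) :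
    fderiv ℝ (coordForm I (diff I V) x) (extChartAt I x x) u v =
      fderiv ℝ (coordForm I (diff I V) x) (extChartAt I x x) v u := by
  have hT := target_mem_nhds (mem_extChartAt_target (I := I) x)
  have hev : coordForm I (diff I V) x =ᶠ[𝓝 (extChartAt I x x)]
      fderiv ℝ (V ∘ (extChartAt I x).symm) := by
    filter_upwards [hT] with e he
    exact coordForm_diff hV he
  rw [hev.fderiv_eq]
  exact (((contDiffOn_comp_symm hV x).contDiffAt hT).isSymmSndFDerivAt
    (by
      rw [minSmoothness_of_isRCLikeNormedField]
      exact WithTop.coe_le_coe.2 (le_top : (2 : ℕ∞) ≤ ⊤))).eq u v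

/-- The equation `d(K dV) = 0` in terms of the components of the endomorphism given by `K`. -/
lemma DKdV.coord_eq {g : Metric I M} {K : SymTensor I M} {V : M → ℝ}
    (h : DKdV g K.val V) (hV : ContMDiff I 𝓘(ℝ, ℝ) ∞ V) (x : M) (u v : E) :
    fderiv ℝ (coordForm I (diff I V) x) (extChartAt I x x) u
        (coordEndo g K x (extChartAt I x x) v)
      + coordForm I (diff I V) x (extChartAt I x x)
        (fderiv ℝ (coordEndo g K x) (extChartAt I x x) u v) =
    fderiv ℝ (coordForm I (diff I V) x) (extChartAt I x x) v
        (coordEndo g K x (extChartAt I x x) u)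
      + coordForm I (diff I V) x (extChartAt I x x)
        (fderiv ℝ (coordEndo g K x) (extChartAt I x x) v u) := by
  have hT := target_mem_nhds (mem_extChartAt_target (I := I) x)
  have key : ∀ a b : E,
      fderiv ℝ (coordForm I (fun p => g.val p (K.val p (diff I V p))) x) (extChartAt I x x) a b =
      fderiv ℝ (coordForm I (diff I V) x) (extChartAt I x x) a
        (coordEndo g K x (extChartAt I x x) b)
      + coordForm I (diff I V) x (extChartAt I x x)
        (fderiv ℝ (coordEndo g K x) (extChartAt I x x) a b) := by
    intro a b
    have h1 := (differentiableAt_of_contDiffOn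
      (contDiffOn_coordForm_endo g K hV x)).hasFDerivAt.clm_apply (hasFDerivAt_const b _)
    have h2 := (differentiableAt_of_contDiffOn
      (contDiffOn_coordForm_diff hV x)).hasFDerivAt.clm_apply
      ((differentiableAt_of_contDiffOn (contDiffOn_coordEndo g K x)).hasFDerivAt.clm_apply
        (hasFDerivAt_const b _))
    have hev : (fun e => coordForm I (fun p => g.val p (K.val p (diff I V p))) x e b)
        =ᶠ[𝓝 (extChartAt I x x)] fun e => coordForm I (diff I V) x e (coordEndo g K x e b) := by
      filter_upwards [hT] with e he
      exact coordForm_endo_apply g K _ he b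
    have h3 := DFunLike.congr_fun ((h1.congr_of_eventuallyEq hev.symm).unique h2) a
    simp only [add_apply, ContinuousLinearMap.comp_apply, ContinuousLinearMap.flip_apply,
      zero_apply, map_zero, zero_add] at h3
    rw [h3]; simp [add_comm]
  have hx := mem_extChartAt_source (I := I) x
  have h0 := h x (coordField I x u x) (coordField I x v x)
  unfold extD at h0
  rw [chartD_coordField hx, chartD_coordField hx, key, key] at h0
  linarith

end Forms

/-! ### The opposite conformal factors of the metric and of $dV$ -/

section Net

variable {ι : Type*} [Fintype ι] [DecidableEq ι]
  {E : ι → Type*} [∀ j, NormedAddCommGroup (E j)] [∀ j, NormedSpace ℝ (E j)]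
  {M : ι → Type*} [∀ j, TopologicalSpace (M j)] [∀ j, ChartedSpace (E j) (M j)]
  {g : Metric (prodModel E) (∀ j, M j)} {K : SymTensor (prodModel E) (∀ j, M j)}
  {lam : ι → (∀ j, M j) → ℝ}
  [∀ j, Nontrivial (E j)] [∀ j, IsManifold 𝓘(ℝ, E j) ∞ (M j)] [∀ j, FiniteDimensional ℝ (E j)]

/-- The metric on `E_i` and the derivatives of `V` along `M i` vary with inverse conformal factors
along the other factors. -/
lemma exists_conformal_factor (hK : IsKillingTensor g K)
    (hlam : ∀ j, ContMDiff (prodModel E) 𝓘(ℝ, ℝ) ∞ (lam j))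
    (hnet : ∀ j p, Module.End.eigenspace (g.endo K p) (lam j p) = productNet E j p)
    {i : ι} (hi : IsKillingDistribution g (productNet E i))
    {V : (∀ j, M j) → ℝ} (hV : ContMDiff (prodModel E) 𝓘(ℝ, ℝ) ∞ V) (hKV : DKdV g K.val V)
    (x : ∀ j, M j) :
    ∃ θ : (∀ j, E j) → ℝ, ∀ j, j ≠ i → ∀ z : E j,
      (∀ u u' : E i,
        fderiv ℝ (coordCov (prodModel E) g.val x) (extChartAt (prodModel E) x x) (Pi.single j z)
          (Pi.single i u) (Pi.single i u') =
        -2 * θ (Pi.single j z) * coordCov (prodModel E) g.val x (extChartAt (prodModel E) x x)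
          (Pi.single i u) (Pi.single i u')) ∧
      ∀ u : E i, fderiv ℝ (coordForm (prodModel E) (diff (prodModel E) V) x)
          (extChartAt (prodModel E) x x) (Pi.single j z) (Pi.single i u) =
        2 * θ (Pi.single j z) * coordForm (prodModel E) (diff (prodModel E) V) x
          (extChartAt (prodModel E) x x) (Pi.single i u) := by
  obtain ⟨-, hsph, hgeo⟩ := hi
  have he := mem_extChartAt_target (I := prodModel E) x
  obtain ⟨θ, hθ⟩ := exists_fderiv_coordCov_of_isSpherical hnet hsph x
  refine ⟨θ, fun j hji z => ⟨hθ j hji z, fun u => ?_⟩⟩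
  -- The derivative of $\lambda_j$ does not involve the chosen vector of $E_j$, so a non-null `z₀`
  -- may replace `z`. Likewise a non-null `u₀` replaces `u` in the next step.
  have hlj : fderiv ℝ (lam j ∘ (extChartAt (prodModel E) x).symm) (extChartAt (prodModel E) x x)
      (Pi.single i u) = 0 := by
    obtain ⟨z₀, hz₀⟩ := exists_coordCov_single_self_ne_zero hnet j he
    exact (mul_eq_zero.1 (hK.fderiv_eigenvalue hlam hnet hji hgeo x u z₀).1).resolve_right hz₀
  have hli : fderiv ℝ (lam i ∘ (extChartAt (prodModel E) x).symm) (extChartAt (prodModel E) x x)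
      (Pi.single j z) = (lam i x - lam j x) * (-2 * θ (Pi.single j z)) := by
    obtain ⟨u₀, hu₀⟩ := exists_coordCov_single_self_ne_zero hnet i he
    have h := (hK.fderiv_eigenvalue hlam hnet hji hgeo x u₀ z).2
    rw [hθ j hji z] at h
    refine mul_right_cancel₀ hu₀ ?_
    rw [h]; ring
  have h := hKV.coord_eq hV x (Pi.single i u) (Pi.single j z)
  rw [coordEndo_single hnet he, coordEndo_single hnet he, fderiv_coordEndo_single hlam hnet,
    fderiv_coordEndo_single hlam hnet, hlj, hli, extChartAt_to_inv] at h
  simp only [map_smul, smul_eq_mul] at h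
  rw [fderiv_coordForm_diff_symm hV x (Pi.single i u)] at h
  -- The equation now reads $\lambda_j V_{zu} = \lambda_i V_{zu} -
  -- 2(\lambda_i-\lambda_j)\theta(z)V_u$.
  refine mul_left_cancel₀ (sub_ne_zero.2 (eigenvalue_ne hnet hji x)) ?_
  linear_combination h

end Net

/-! ### Constancy of $K_i\,dV$ along the other factors -/

section Net

variable {ι : Type*} [Fintype ι] [DecidableEq ι]
  {E : ι → Type*} [∀ j, NormedAddCommGroup (E j)] [∀ j, NormedSpace ℝ (E j)]
  {M : ι → Type*} [∀ j, TopologicalSpace (M j)] [∀ j, ChartedSpace (E j) (M j)]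

/-- The component along `M i` of the one-form `η`, in the preferred coordinates of `M i`. -/
def partialForm (i : ι) (η : ∀ p : ∀ j, M j, TangentSpace (prodModel E) p →L[ℝ] ℝ)
    (p : ∀ j, M j) (u : E i) : ℝ :=
  η p (Pi.single i u : ∀ j, E j)

variable [∀ j, IsManifold 𝓘(ℝ, E j) ∞ (M j)]

/-- The preferred chart of the product may jump as the `j`-th coordinate moves, but its `i`-th
factor depends only on the fixed point `x i`, where the chart differential is the identity. -/
lemma coordForm_update_single (η : ∀ p : ∀ j, M j, TangentSpace (prodModel E) p →L[ℝ] ℝ)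
    (x : ∀ j, M j) {i j : ι} (hji : j ≠ i) {e : E j}
    (he : e ∈ (extChartAt 𝓘(ℝ, E j) (x j)).target) (u : E i) :
    coordForm (prodModel E) η x (Function.update (extChartAt (prodModel E) x x) j e)
        (Pi.single i u) =
      partialForm i η (Function.update x j ((extChartAt 𝓘(ℝ, E j) (x j)).symm e)) u := by
  have hT : Function.update (extChartAt (prodModel E) x x) j e ∈
      (extChartAt (prodModel E) x).target := by
    rw [mem_extChartAt_pi_target]
    intro k
    by_cases hk : k = j
    · subst hk; rwa [Function.update_self]
    · rw [Function.update_of_ne hk]; exact mem_extChartAt_target (I := 𝓘(ℝ, E k)) (x k)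
  have hp : (extChartAt (prodModel E) x).symm
      (Function.update (extChartAt (prodModel E) x x) j e) =
      Function.update x j ((extChartAt 𝓘(ℝ, E j) (x j)).symm e) := by
    funext k
    rw [extChartAt_pi_symm_apply]
    by_cases hk : k = j
    · subst hk; rw [Function.update_self, Function.update_self]
    · rw [Function.update_of_ne hk, Function.update_of_ne hk]
      exact extChartAt_to_inv (I := 𝓘(ℝ, E k)) (x k)
  have hu : (chartSymmD 𝓘(ℝ, E i) (x i)
      (Function.update (extChartAt (prodModel E) x x) j e i) u : E i) = u := by
    have h : ∀ e' : E i, e' = extChartAt 𝓘(ℝ, E i) (x i) (x i) →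
        (chartSymmD 𝓘(ℝ, E i) (x i) e' u : E i) = u := by
      rintro _ rfl
      exact chartSymmD_self (I := 𝓘(ℝ, E i)) (x i) u
    exact h _ (Function.update_of_ne hji.symm _ _)
  rw [← hp]
  refine congrArg (η _) ((chartSymmD_single hT i u).trans ?_)
  exact congrArg (Pi.single (M := E) i) hu

/-- A function of `q` along the leaf of `M j` through `x`, with derivative zero in the chart at `x`,
has differential zero at `x`. -/
lemma hasMFDerivAt_partialForm_zero
    {η : ∀ p : ∀ j, M j, TangentSpace (prodModel E) p →L[ℝ] ℝ} {i j : ι} (hji : j ≠ i) {u : E i}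
    (x : ∀ j, M j)
    (h : HasFDerivAt (fun e : E j => coordForm (prodModel E) η x
      (Function.update (extChartAt (prodModel E) x x) j e) (Pi.single i u)) (0 : E j →L[ℝ] ℝ)
      (extChartAt 𝓘(ℝ, E j) (x j) (x j))) :
    HasMFDerivAt 𝓘(ℝ, E j) 𝓘(ℝ, ℝ) (fun q => partialForm i η (Function.update x j q) u) (x j)
      (0 : E j →L[ℝ] ℝ) := by
  have hT := target_mem_nhds (mem_extChartAt_target (I := 𝓘(ℝ, E j)) (x j))
  have h1 : HasFDerivAt (fun e : E j => partialForm i η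
      (Function.update x j ((extChartAt 𝓘(ℝ, E j) (x j)).symm e)) u) (0 : E j →L[ℝ] ℝ)
      (extChartAt 𝓘(ℝ, E j) (x j) (x j)) := by
    refine h.congr_of_eventuallyEq ?_
    filter_upwards [hT] with e he
    exact (coordForm_update_single η x hji he u).symm
  refine (hasMFDerivAt_iff_of_boundaryless _).2 ⟨?_, h1⟩
  have h2 := h1.continuousAt.comp (continuousAt_extChartAt (I := 𝓘(ℝ, E j)) (x j))
  refine h2.congr ?_
  filter_upwards [extChartAt_source_mem_nhds (I := 𝓘(ℝ, E j)) (x j)] with q hq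
  simp only [Function.comp_apply]
  rw [(extChartAt 𝓘(ℝ, E j) (x j)).left_inv hq]

lemma partialForm_eq_of_apply_eq [∀ j, PreconnectedSpace (M j)]
    {η : ∀ p : ∀ j, M j, TangentSpace (prodModel E) p →L[ℝ] ℝ} {i : ι} {u : E i}
    (h : ∀ x : ∀ j, M j, ∀ j, j ≠ i → HasMFDerivAt 𝓘(ℝ, E j) 𝓘(ℝ, ℝ)
      (fun q => partialForm i η (Function.update x j q) u) (x j) (0 : E j →L[ℝ] ℝ))
    {p p' : ∀ j, M j} (hp : p i = p' i) : partialForm i η p u = partialForm i η p' u := by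
  have step : ∀ (p : ∀ j, M j) (j : ι), j ≠ i → ∀ q q' : M j,
      partialForm i η (Function.update p j q) u = partialForm i η (Function.update p j q') u := by
    intro p j hj q q'
    refine apply_eq_of_hasMFDerivAt_zero (E := E j)
      (f := fun q => partialForm i η (Function.update p j q) u) (fun r => ?_) q q'
    -- The hypothesis differentiates only at the base point itself, so the leaf is re-based at its
    -- point with `j`-th coordinate `r`.
    obtain ⟨x, hx, rfl⟩ : ∃ x : ∀ j, M j,
        (∀ q, Function.update x j q = Function.update p j q) ∧ x j = r :=
      ⟨Function.update p j r, fun q => Function.update_idem _ _ _, Function.update_self _ _ _⟩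
    have h1 : (fun q => partialForm i η (Function.update p j q) u) =
        fun q => partialForm i η (Function.update x j q) u := by
      funext q; rw [hx]
    rw [h1]
    exact h x j hj
  -- Passing from `p` to `p'` by changing one coordinate other than the `i`-th at a time.
  have key : ∀ s : Finset ι, i ∉ s →
      partialForm i η (s.piecewise p' p) u = partialForm i η p u := by
    intro s
    induction s using Finset.induction_on with
    | empty => intro _; rw [Finset.piecewise_empty]
    | insert j s hj ih =>
      intro hs
      rw [Finset.mem_insert, not_or] at hs
      rw [Finset.piecewise_insert, ← ih hs.2,
        step (s.piecewise p' p) j (Ne.symm hs.1) (p' j) (s.piecewise p' p j),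
        Function.update_eq_self]
  have hfin : (Finset.univ.erase i).piecewise p' p = p' := by
    funext k
    by_cases hk : k = i
    · subst hk; simp [hp]
    · simp [hk]
  rw [← key (Finset.univ.erase i) (by simp), hfin]

variable {g : Metric (prodModel E) (∀ j, M j)} {K : SymTensor (prodModel E) (∀ j, M j)}
  {lam : ι → (∀ j, M j) → ℝ}
  [∀ j, Nontrivial (E j)] [∀ j, FiniteDimensional ℝ (E j)]

/-- The component along `M i` of `K_i dV` is constant along the other factors. -/
lemma hasMFDerivAt_partialForm_liftTensor (hK : IsKillingTensor g K)
    (hlam : ∀ j, ContMDiff (prodModel E) 𝓘(ℝ, ℝ) ∞ (lam j))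
    (hnet : ∀ j p, Module.End.eigenspace (g.endo K p) (lam j p) = productNet E j p)
    {i : ι} (hi : IsKillingDistribution g (productNet E i)) (Ki : SymTensor 𝓘(ℝ, E i) (M i))
    {V : (∀ j, M j) → ℝ} (hV : ContMDiff (prodModel E) 𝓘(ℝ, ℝ) ∞ V) (hKV : DKdV g K.val V)
    (x : ∀ j, M j) {j : ι} (hji : j ≠ i) (u : E i) :
    HasMFDerivAt 𝓘(ℝ, E j) 𝓘(ℝ, ℝ) (fun q => partialForm i
      (fun p => g.val p (liftTensor i Ki p (diff (prodModel E) V p))) (Function.update x j q) u)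
      (x j) (0 : E j →L[ℝ] ℝ) := by
  refine hasMFDerivAt_partialForm_zero hji x ?_
  have he := mem_extChartAt_target (I := prodModel E) x
  obtain ⟨θ, hθ⟩ := exists_conformal_factor hK hlam hnet hi hV hKV x
  set e₀ := extChartAt (prodModel E) x x
  set S := ContinuousLinearMap.single ℝ E i
  set c₀ := coordContra 𝓘(ℝ, E i) Ki.val (x i) (e₀ i)
  set A := coordCov (prodModel E) g.val x
  set dV := coordForm (prodModel E) (diff (prodModel E) V) x
  have hup : HasFDerivAt (Function.update e₀ j) (ContinuousLinearMap.single ℝ E j) (e₀ j) :=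
    hasFDerivAt_update_single e₀ j (e₀ j)
  have hself : Function.update e₀ j (e₀ j) = e₀ := Function.update_eq_self j e₀
  have hAd : HasFDerivAt (fun e => A (Function.update e₀ j e)) _ (e₀ j) :=
    HasFDerivAt.comp (e₀ j) (g := A) (g' := fderiv ℝ A e₀) (by
      rw [hself]; exact (differentiableAt_of_contDiffOn (g.smooth x)).hasFDerivAt) hup
  have hVd : HasFDerivAt (fun e => dV (Function.update e₀ j e)) _ (e₀ j) :=
    HasFDerivAt.comp (e₀ j) (g := dV) (g' := fderiv ℝ dV e₀) (by
      rw [hself]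
      exact (differentiableAt_of_contDiffOn (contDiffOn_coordForm_diff hV x)).hasFDerivAt) hup
  -- The components of $K_i$, frozen at `e₀ i`: moving the `j`-th coordinate leaves them unchanged,
  -- so only the metric and $dV$ are differentiated.
  let P : ((∀ j, E j) →L[ℝ] ℝ) →L[ℝ] (∀ j, E j) :=
    S.comp (c₀.comp (ContinuousLinearMap.precomp ℝ S))
  have hPd : HasFDerivAt (fun e => P (dV (Function.update e₀ j e))) _ (e₀ j) :=
    P.hasFDerivAt.comp (e₀ j) hVd
  have hF := (hAd.clm_apply hPd).clm_apply (hasFDerivAt_const (Pi.single i u : ∀ j, E j) (e₀ j))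
  have hev : (fun e : E j => coordForm (prodModel E)
      (fun p => g.val p (liftTensor i Ki p (diff (prodModel E) V p))) x
      (Function.update e₀ j e) (Pi.single i u)) =ᶠ[𝓝 (e₀ j)]
      fun e => A (Function.update e₀ j e) (P (dV (Function.update e₀ j e))) (Pi.single i u) := by
    have hT : (extChartAt (prodModel E) x).target ∈ 𝓝 (Function.update e₀ j (e₀ j)) := by
      rw [hself]; exact target_mem_nhds he
    filter_upwards [hup.continuousAt.preimage_mem_nhds hT] with e he'
    rw [coordForm_endo g _ _ he', coordContra_liftTensor i Ki he', Function.update_of_ne hji.symm]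
    rfl
  refine (hF.congr_of_eventuallyEq hev).congr_fderiv ?_
  ext z
  have hz := hθ j hji z
  have hPS : ∀ α, P α = Pi.single i (c₀ (α.comp S)) := fun α => rfl
  have hH : (fderiv ℝ dV e₀ (Pi.single j z)).comp S =
      (2 * θ (Pi.single j z)) • (dV e₀).comp S := by
    ext v
    exact hz.2 v
  simp only [add_apply, ContinuousLinearMap.comp_apply, ContinuousLinearMap.flip_apply,
    zero_apply, map_zero, zero_add, hself, ContinuousLinearMap.single_apply]
  -- The contribution $2\theta(z)$ from $dV$ cancels $-2\theta(z)$ from the metric.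
  rw [hPS, hPS, hH, hz.1, map_smul, Pi.single_smul, map_smul, smul_apply, smul_eq_mul]
  ring

/-- The one-form `K_i dV` is, up to the factor `c`, the pullback of the one-form `K̃_i dV_i`. -/
lemma val_liftTensor_eq [∀ j, PreconnectedSpace (M j)] (hK : IsKillingTensor g K)
    (hlam : ∀ j, ContMDiff (prodModel E) 𝓘(ℝ, ℝ) ∞ (lam j))
    (hnet : ∀ j p, Module.End.eigenspace (g.endo K p) (lam j p) = productNet E j p)
    {i : ι} (hi : IsKillingDistribution g (productNet E i))
    (pbar : ∀ j, M j) (gi : Metric 𝓘(ℝ, E i) (M i)) (c : ℝ)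
    (hgi : ∀ (q : M i) (u v : TangentSpace 𝓘(ℝ, E i) q),
      g.val (leafMap pbar i q) (leafMapD E pbar i q u) (leafMapD E pbar i q v) = c * gi.val q u v)
    (Ki : SymTensor 𝓘(ℝ, E i) (M i))
    {V : (∀ j, M j) → ℝ} (hV : ContMDiff (prodModel E) 𝓘(ℝ, ℝ) ∞ V) (hKV : DKdV g K.val V)
    (p : ∀ j, M j) (w : ∀ j, E j) :
    g.val p (liftTensor i Ki p (diff (prodModel E) V p)) w =
      c * gi.val (p i) (Ki.val (p i) (diff 𝓘(ℝ, E i) (V ∘ leafMap pbar i) (p i))) (w i) := by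
  set η : ∀ p : ∀ j, M j, TangentSpace (prodModel E) p →L[ℝ] ℝ :=
    fun p => g.val p (liftTensor i Ki p (diff (prodModel E) V p)) with hη
  -- The vector obtained from $dV$ by the lift lies in $E_i$, hence is orthogonal to every other
  -- $E_j$.
  have h1 : η p w = partialForm i η p (w i) := by
    have hw : η p w = ∑ j, η p (Pi.single j (w j) : ∀ j, E j) := by
      conv_lhs => rw [← Finset.univ_sum_single w]
      exact map_sum (η p) _ _
    rw [hw, Finset.sum_eq_single i]
    · rfl
    · intro j _ hj
      exact productNet_orthogonal hnet hj.symm (LinearMap.mem_range_self _ _)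
        (mem_productNet.2 ⟨w j, rfl⟩)
    · intro h; exact absurd (Finset.mem_univ i) h
  have h2 : partialForm i η p (w i) = partialForm i η (leafMap pbar i (p i)) (w i) :=
    partialForm_eq_of_apply_eq
      (fun x j hj => hasMFDerivAt_partialForm_liftTensor hK hlam hnet hi Ki hV hKV x hj (w i))
      (Function.update_self i (p i) pbar).symm
  have h3 : ∀ (q : M i) (u : E i), partialForm i η (leafMap pbar i q) u =
      c * gi.val q (Ki.val q (diff 𝓘(ℝ, E i) (V ∘ leafMap pbar i) q)) u := by
    intro q u
    have hd : diff 𝓘(ℝ, E i) (V ∘ leafMap pbar i) q =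
        (diff (prodModel E) V (leafMap pbar i q)).comp (leafMapD E pbar i q) :=
      mfderiv_comp q (hV.mdifferentiableAt (by simp))
        (hasMFDerivAt_leafMap pbar i q).mdifferentiableAt
    have hKq : ∀ q' : M i, q' = q → (Ki.val q' : (E i →L[ℝ] ℝ) →L[ℝ] E i) = Ki.val q := by
      rintro _ rfl; rfl
    refine Eq.trans ?_ (hgi q (Ki.val q (diff 𝓘(ℝ, E i) (V ∘ leafMap pbar i) q)) u)
    rw [hd]
    have hl : liftTensor i Ki (leafMap pbar i q) (diff (prodModel E) V (leafMap pbar i q)) =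
        leafMapD E pbar i q (Ki.val q ((diff (prodModel E) V (leafMap pbar i q)).comp
          (leafMapD E pbar i q))) := by
      refine (factorIncl_apply _ i _).trans (Eq.trans ?_ (leafMapD_apply pbar i q _).symm)
      refine congrArg (Pi.single (M := E) i) ?_
      refine (DFunLike.congr_fun (hKq (leafMap pbar i q i) (Function.update_self i q pbar)) _).trans ?_
      refine congrArg (Ki.val q) ?_
      ext v
      refine congrArg (diff (prodModel E) V (leafMap pbar i q)) ?_
      exact (factorIncl_apply _ i v).trans (leafMapD_apply pbar i q v).symm
    change g.val _ (liftTensor i Ki (leafMap pbar i q) _) (Pi.single i u : ∀ j, E j) = _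
    rw [hl]
    exact congrArg _ (leafMapD_apply pbar i q u).symm
  rw [h1, h2, h3]

/-! ### Exterior derivative of a pullback along a projection -/

omit [DecidableEq ι] [∀ j, Nontrivial (E j)] [∀ j, FiniteDimensional ℝ (E j)] in
/-- The exterior derivative of a constant multiple of the pullback of a one-form on `M i`. -/
lemma extD_of_eq_pullback {i : ι} {c : ℝ}
    {η : ∀ p : ∀ j, M j, TangentSpace (prodModel E) p →L[ℝ] ℝ}
    {ζ : ∀ q : M i, TangentSpace 𝓘(ℝ, E i) q →L[ℝ] ℝ}
    (h : ∀ (p : ∀ j, M j) (w : ∀ j, E j), η p w = c * ζ (p i) (w i)) (x : ∀ j, M j)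
    (hζ : DifferentiableAt ℝ (coordForm 𝓘(ℝ, E i) ζ (x i)) (extChartAt 𝓘(ℝ, E i) (x i) (x i)))
    (u v : ∀ j, E j) :
    extD (prodModel E) η x u v = c * extD 𝓘(ℝ, E i) ζ (x i) (u i) (v i) := by
  -- In product charts the projection to $M_i$ is linear, so pulling back and scaling by `c` is a
  -- constant linear map on components.
  let R : (E i →L[ℝ] ℝ) →L[ℝ] (∀ j, E j) →L[ℝ] ℝ :=
    c • ContinuousLinearMap.precomp ℝ (ContinuousLinearMap.proj (R := ℝ) (φ := E) i)
  have hev : coordForm (prodModel E) η x =ᶠ[𝓝 (extChartAt (prodModel E) x x)]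
      fun e => R (coordForm 𝓘(ℝ, E i) ζ (x i) (e i)) := by
    filter_upwards [target_mem_nhds (mem_extChartAt_target (I := prodModel E) x)] with e he
    ext w
    refine (h _ (chartSymmD (prodModel E) x e w)).trans ?_
    exact congrArg (fun t => c * ζ _ t) (chartSymmD_pi_apply he w i)
  have hd : HasFDerivAt (fun e : ∀ j, E j => R (coordForm 𝓘(ℝ, E i) ζ (x i) (e i)))
      (R.comp ((fderiv ℝ (coordForm 𝓘(ℝ, E i) ζ (x i)) (extChartAt 𝓘(ℝ, E i) (x i) (x i))).comp
        (ContinuousLinearMap.proj i))) (extChartAt (prodModel E) x x) :=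
    R.hasFDerivAt.comp _ (HasFDerivAt.comp (extChartAt (prodModel E) x x)
      (f := fun e : ∀ j, E j => e i) hζ.hasFDerivAt
      (ContinuousLinearMap.proj (R := ℝ) (φ := E) i).hasFDerivAt)
  have h1 : ∀ a b : ∀ j, E j, fderiv ℝ (coordForm (prodModel E) η x)
      (extChartAt (prodModel E) x x) (chartD (prodModel E) x x a) (chartD (prodModel E) x x b) =
      c * fderiv ℝ (coordForm 𝓘(ℝ, E i) ζ (x i)) (extChartAt 𝓘(ℝ, E i) (x i) (x i))
        (chartD 𝓘(ℝ, E i) (x i) (x i) (a i)) (chartD 𝓘(ℝ, E i) (x i) (x i) (b i)) := by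
    intro a b
    rw [hev.fderiv_eq, hd.fderiv]
    refine congrArg₂ (fun s t => c * fderiv ℝ (coordForm 𝓘(ℝ, E i) ζ (x i))
      (extChartAt 𝓘(ℝ, E i) (x i) (x i)) s t) ?_ ?_
    · exact (congrFun (chartD_self (I := prodModel E) x a) i).trans
        (chartD_self (I := 𝓘(ℝ, E i)) (x i) (a i)).symm
    · exact (congrFun (chartD_self (I := prodModel E) x b) i).trans
        (chartD_self (I := 𝓘(ℝ, E i)) (x i) (b i)).symm
  unfold extD
  rw [mul_sub]
  exact congrArg₂ (· - ·) (h1 u v) (h1 v u)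

end Net

end PseudoRiem

end

/-! ### The reduction theorem -/

theorem mainTheorem8
    {ι : Type*} [Fintype ι] [DecidableEq ι]
    {E : ι → Type*} [∀ j, NormedAddCommGroup (E j)] [∀ j, NormedSpace ℝ (E j)]
    [∀ j, FiniteDimensional ℝ (E j)] [∀ j, Nontrivial (E j)]
    {M : ι → Type*} [∀ j, TopologicalSpace (M j)] [∀ j, ChartedSpace (E j) (M j)]
    [∀ j, IsManifold 𝓘(ℝ, E j) ∞ (M j)]
    -- `M = ∏ j, M j` is connected, with a pseudo-Riemannian metric `g`
    [ConnectedSpace (∀ j, M j)]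
    (g : PseudoRiem.Metric (PseudoRiem.prodModel E) (∀ j, M j))
    -- `K` is a Killing tensor whose eigenspaces form the product net, with eigenfunctions `lam j`
    (K : PseudoRiem.SymTensor (PseudoRiem.prodModel E) (∀ j, M j))
    (hK : PseudoRiem.IsKillingTensor g K)
    (lam : ι → (∀ j, M j) → ℝ)
    (hlam : ∀ j, ContMDiff (PseudoRiem.prodModel E) 𝓘(ℝ, ℝ) ∞ (lam j))
    (hnet : ∀ j p, Module.End.eigenspace (g.endo K p) (lam j p) = PseudoRiem.productNet E j p)
    -- the eigenspace `E_i` is Killing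
    (i : ι) (hi : PseudoRiem.IsKillingDistribution g (PseudoRiem.productNet E i))
    -- `gi` is the metric of the factor `M i`: up to a positive constant factor, it is the metric
    -- induced on the leaf of `M i` through `pbar`
    (pbar : ∀ j, M j) (gi : PseudoRiem.Metric 𝓘(ℝ, E i) (M i)) (c : ℝ) (hc : 0 < c)
    (hgi : ∀ (q : M i) (u v : TangentSpace 𝓘(ℝ, E i) q),
      g.val (PseudoRiem.leafMap pbar i q) (PseudoRiem.leafMapD E pbar i q u)
        (PseudoRiem.leafMapD E pbar i q v) = c * gi.val q u v)
    -- `Ki` is a Killing tensor on the factor `M i`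
    (Ki : PseudoRiem.SymTensor 𝓘(ℝ, E i) (M i)) (hKi : PseudoRiem.IsKillingTensor gi Ki)
    (V : (∀ j, M j) → ℝ) (hV : ContMDiff (PseudoRiem.prodModel E) 𝓘(ℝ, ℝ) ∞ V)
    (hKV : PseudoRiem.DKdV g K.val V) :
    PseudoRiem.DKdV g (PseudoRiem.liftTensor i Ki) V ↔
      PseudoRiem.DKdV gi Ki.val (V ∘ PseudoRiem.leafMap pbar i) := by
  -- Each factor is the image of the connected product under a projection, surjective because `pbar`
  -- makes all factors nonempty.
  have hconn : ∀ j, PreconnectedSpace (M j) := fun j => by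
    have : ∀ k, Nonempty (M k) := fun k => ⟨pbar k⟩
    refine ⟨?_⟩
    rw [← (Function.surjective_eval (β := M) j).range_eq]
    exact isPreconnected_range (continuous_apply j)
  have hleaf : ContMDiff 𝓘(ℝ, E i) 𝓘(ℝ, ℝ) ∞ (V ∘ PseudoRiem.leafMap pbar i) :=
    hV.comp (PseudoRiem.contMDiff_leafMap pbar i)
  have key := fun (x : ∀ j, M j) (u v : ∀ j, E j) => PseudoRiem.extD_of_eq_pullback
    (PseudoRiem.val_liftTensor_eq hK hlam hnet hi pbar gi c hgi Ki hV hKV) x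
    (PseudoRiem.differentiableAt_of_contDiffOn
      (PseudoRiem.contDiffOn_coordForm_endo gi Ki hleaf (x i))) u v
  constructor
  · intro h q u v
    have h1 := ((key (PseudoRiem.leafMap pbar i q) (Pi.single (M := E) i u)
      (Pi.single (M := E) i v)).symm.trans (h _ _ _))
    -- The `i`-th entries of the leaf point and of the vectors equal `q`, `u`, `v` only
    -- propositionally; this transports the dependent statement.
    have h2 : ∀ (q' : M i) (u' v' : E i), q' = q → u' = u → v' = v →
        PseudoRiem.extD 𝓘(ℝ, E i) (fun p => gi.val p (Ki.val p
          (PseudoRiem.diff 𝓘(ℝ, E i) (V ∘ PseudoRiem.leafMap pbar i) p))) q' u' v' = 0 →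
        PseudoRiem.extD 𝓘(ℝ, E i) (fun p => gi.val p (Ki.val p
          (PseudoRiem.diff 𝓘(ℝ, E i) (V ∘ PseudoRiem.leafMap pbar i) p))) q u v = 0 := by
      rintro _ _ _ rfl rfl rfl h3
      exact h3
    exact h2 _ _ _ (Function.update_self i q pbar) (Pi.single_eq_same (M := E) i u)
      (Pi.single_eq_same (M := E) i v) ((mul_eq_zero.1 h1).resolve_left hc.ne')
  · intro h x u v
    exact (key x u v).trans (mul_eq_zero_of_right c (h _ _ _))
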